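/- Let $n<m$ be positive integers. For each prime $p$ let $U_p\subseteq\mathbb{Z}_p^{n\times m}$ be the set of matrices all of whose $n$-minors ($n\times n$ subdeterminants) are divisible by $p$, and put $U_\infty=\emptyset\subseteq\mathbb{R}^{n\times m}$. For $A\in\mathbb{Z}^{n\times m}$ let $P(A)=\{\nu\in\{\infty\}\cup\mathcal P : A\in U_\nu\}$, where $\mathcal P$ is the set of primes; thus $P(A)$ is the set of primes dividing all $n$-minors of $A$. Let $I=\{A\in\mathbb{Z}^{n\times m}: P(A)\text{ is infinite}\}$, let $[-H,H[^{nm}_I$ be the set of integer $n\times m$ matrices with all entries in $[-H,H[$ that are not in $I$, and let $R\subseteq\mathbb{Z}^{n\times m}$ be the set of rectangular unimodular matrices, i.e. of those matrices that are the first $n$ rows of some matrix in $\mathrm{GL}_m(\mathbb{Z})$. Let $s_p=\mu_p(U_p)$, where $\mu_p$ is the normalized Haar measure on $\mathbb{Z}_p^{n\times m}$, and $s_\infty=2^{-nm}\mathrm{vol}(U_\infty\cap[-1,1]^{nm})=0$. Write $\bar\rho(T)=\limsup_{H\to\infty}|T\cap[-H,H[^{nm}|/(2H)^{nm}$ for $T\subseteq\mathbb{Z}^{n\times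 m}$. Then: (a) The system $(U_\nu)$ satisfies the hypotheses of the local to global principle for densities and corresponds to $R^C=\mathbb{Z}^{n\times m}\setminus R$. That is, $\mathbb{R}_{\ge 0}\cdot U_\infty=U_\infty$, the boundaries of $U_\infty$ and of all $U_p$ are null sets, $\lim_{M\to\infty}\bar\rho(\{A\in\mathbb{Z}^{n\times m}: A\in U_p\text{ for some prime }p>M\})=0$, and $R=\{A\in\mathbb{Z}^{n\times m}:P(A)=\emptyset\}$. (b) The expected value of the system, $$\mu=\lim_{H\to\infty}\frac{\sum_{A\in[-H,H[^{nm}_I}|P(A)|}{(2H)^{nm}},$$ exists (as a finite real number), and, both series being convergent, $$\mu=\sum_{\nu\in\{\infty\}\cup\mathcal P}s_\nu=\sum_{p\in\mathcal P}\left(1-\prod_{i=0}^{n-1}\left(1-\frac1{p^{m-i}}\right)\right).$$ (c) The average number of primes dividing all $n$-minors of a rectangular non-unimodular matrix, $$\mu_{R^C}=\lim_{H\to\infty}\frac{\sum_{A\in[-H,H[^{nm}_I\cap R^C}|P(A)|}{\left|[-H,H[^{nm}_I\cap R^C\right|},$$ exists and equals $$\mu_{R^C}=\frac{\mu}{1-\prod_{i=0}^{n-1}\frac1{\zeta(m-i)}},$$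 where $\zeta$ is the Riemann zeta function. -/

import Mathlib

/-! ### Density on `ℤ^d`

The coordinates are indexed by a finite type `ι`, so that `d = Fintype.card ι`. -/

namespace LocalGlobal

/-- The integer points of the half-open box `[-H, H[^d`. -/
noncomputable def box (ι : Type) [Fintype ι] [DecidableEq ι] (H : ℕ) : Finset (ι → ℤ) :=
  Fintype.piFinset fun _ => Finset.Ico (-(H : ℤ)) (H : ℤ)

open Classical in
/-- The proportion `|T ∩ [-H, H[^d| / (2H)^d`. -/
noncomputable def boxProportion {ι : Type} [Fintype ι] [DecidableEq ι]
    (T : Set (ι → ℤ)) (H : ℕ) : ℝ :=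
  (((box ι H).filter (fun A => A ∈ T)).card : ℝ) / (2 * (H : ℝ)) ^ Fintype.card ι

/-- The upper density of `T ⊆ ℤ^d`. The proportions lie in `[0, 1]`, so the real `limsup` is the
genuine one. -/
noncomputable def upperDensity {ι : Type} [Fintype ι] [DecidableEq ι] (T : Set (ι → ℤ)) : ℝ :=
  Filter.limsup (fun H : ℕ => boxProportion T H) Filter.atTop

/-! ### Systems of local conditions -/

/-- The places of `ℚ`: `none` is the archimedean place `∞`, `some p` is the prime `p`. -/
abbrev Place : Type := Option Nat.Primes

instance factPrime (p : Nat.Primes) : Fact (p : ℕ).Prime := ⟨p.2⟩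

/-- The Haar measure on (the Borel sets of) `ℤ_p^d`, normalized to have total mass one. -/
noncomputable def padicHaar (ι : Type) [Fintype ι] (p : Nat.Primes) :
    @MeasureTheory.Measure (ι → ℤ_[(p : ℕ)]) (borel _) :=
  letI : MeasurableSpace (ι → ℤ_[(p : ℕ)]) := borel _
  haveI : BorelSpace (ι → ℤ_[(p : ℕ)]) := ⟨rfl⟩
  MeasureTheory.Measure.addHaarMeasure ⊤

/-- A family `(U_ν)` with `U_∞ ⊆ ℝ^d` and `U_p ⊆ ℤ_p^d` for every prime `p`. -/
structure System (ι : Type) where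
  /-- the set `U_∞` -/
  atInfinity : Set (ι → ℝ)
  /-- the sets `U_p` -/
  atPrime : ∀ p : Nat.Primes, Set (ι → ℤ_[(p : ℕ)])

namespace System

variable {ι : Type}

/-- `A ∈ U_ν`, for an integer point `A`. -/
def Mem (U : System ι) (A : ι → ℤ) : Place → Prop
  | none => (fun i => (A i : ℝ)) ∈ U.atInfinity
  | some p => (fun i => (A i : ℤ_[(p : ℕ)])) ∈ U.atPrime p

/-- The set `P(A) = {ν | A ∈ U_ν}` of places. -/
def places (U : System ι) (A : ι → ℤ) : Set Place := {ν | U.Mem A ν}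

/-- The set `I` of integer points that lie in `U_ν` for infinitely many places `ν`. -/
def exceptional (U : System ι) : Set (ι → ℤ) := {A | (U.places A).Infinite}

/-- The local measures: `s_∞ = 2^{-d} μ_∞(U_∞ ∩ [-1, 1]^d)` and `s_p = μ_p(U_p)`. -/
noncomputable def localMeasure [Fintype ι] (U : System ι) : Place → ℝ
  | none => (MeasureTheory.volume (U.atInfinity ∩ Set.Icc (-1) 1)).toReal / 2 ^ Fintype.card ι
  | some p => (padicHaar ι p (U.atPrime p)).toReal

/-- The hypotheses of the local to global principle for densities. -/
structure IsAdmissible [Fintype ι] [DecidableEq ι] (U : System ι) : Prop where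
  /-- `ℝ_{≥ 0} · U_∞ = U_∞` -/
  cone : Set.image2 (fun (t : ℝ) (x : ι → ℝ) => t • x) (Set.Ici 0) U.atInfinity = U.atInfinity
  /-- the boundary of `U_∞` is a Lebesgue null set -/
  frontier_infinity : MeasureTheory.volume (frontier U.atInfinity) = 0
  /-- the boundary of each `U_p` is a Haar null set -/
  frontier_prime : ∀ p : Nat.Primes, padicHaar ι p (frontier (U.atPrime p)) = 0
  /-- the upper density of `{A | A ∈ U_p for some prime p > M}` tends to `0` as `M → ∞` -/
  tail : Filter.Tendsto
    (fun M : ℕ => upperDensity {A : ι → ℤ | ∃ p : Nat.Primes, M < (p : ℕ) ∧ U.Mem A (some p)})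
    Filter.atTop (nhds 0)

/-- The system corresponds to `T ⊆ ℤ^d`: it satisfies the hypotheses of the local to global
principle and the complement of `T` is the set of points that lie in no `U_ν`. -/
def CorrespondsTo [Fintype ι] [DecidableEq ι] (U : System ι) (T : Set (ι → ℤ)) : Prop :=
  U.IsAdmissible ∧ Tᶜ = {A | U.places A = ∅}

open Classical in
/-- The expected value of the system exists and equals `μ`. (Outside `exceptional`, the set
`places A` is finite, and `ncard` is its number of elements.) -/
def HasExpectedValue [Fintype ι] [DecidableEq ι] (U : System ι) (μ : ℝ) : Prop :=
  Filter.Tendsto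
    (fun H : ℕ =>
      (∑ A ∈ (box ι H).filter (fun A => A ∉ U.exceptional), ((U.places A).ncard : ℝ)) /
        (2 * (H : ℝ)) ^ Fintype.card ι)
    Filter.atTop (nhds μ)

open Classical in
/-- The expected value of the system restricted to `T` exists and equals `μ`. -/
def HasExpectedValueOn [Fintype ι] [DecidableEq ι] (U : System ι) (T : Set (ι → ℤ)) (μ : ℝ) :
    Prop :=
  Filter.Tendsto
    (fun H : ℕ =>
      (∑ A ∈ (box ι H).filter (fun A => A ∉ U.exceptional ∧ A ∈ T), ((U.places A).ncard : ℝ)) /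
        (((box ι H).filter (fun A => A ∉ U.exceptional ∧ A ∈ T)).card : ℝ))
    Filter.atTop (nhds μ)

end System

/-! ### Rectangular matrices

An `n × m` matrix over `R` is regarded as a point of `R^{nm}`, with coordinates indexed by
`Fin n × Fin m`. -/

/-- The `n × m` matrix with the given family of entries. -/
def toMatrix {R : Type} {n m : ℕ} (A : Fin n × Fin m → R) : Matrix (Fin n) (Fin m) R :=
  Matrix.of fun i j => A (i, j)

/-- The `n`-minor of an `n × m` matrix on the columns `c 0 < c 1 < ⋯ < c (n - 1)`. -/
def rowMinor {R : Type} [CommRing R] {n m : ℕ} (A : Matrix (Fin n) (Fin m) R)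
    (c : Fin n ↪o Fin m) : R :=
  (A.submatrix id c).det

/-- An `n × m` integer matrix with `n ≤ m` is rectangular unimodular if it consists of the first
`n` rows of some `m × m` integer matrix that is invertible over `ℤ`. -/
def IsRectangularUnimodular {n m : ℕ} (A : Matrix (Fin n) (Fin m) ℤ) : Prop :=
  ∃ (h : n ≤ m) (B : Matrix (Fin m) (Fin m) ℤ), IsUnit B ∧ ∀ i j, B (Fin.castLE h i) j = A i j

/-- The system with `U_∞ = ∅` and `U_p` the set of the `n × m` matrices over `ℤ_p` all of whose
`n`-minors are divisible by `p`. -/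
def minorSystem (n m : ℕ) : System (Fin n × Fin m) where
  atInfinity := ∅
  atPrime p := {A | ∀ c : Fin n ↪o Fin m, ((p : ℕ) : ℤ_[(p : ℕ)]) ∣ rowMinor (toMatrix A) c}

/-- The set `R` of rectangular unimodular matrices in `ℤ^{n × m}`. -/
def unimodularSet (n m : ℕ) : Set (Fin n × Fin m → ℤ) :=
  {A | IsRectangularUnimodular (toMatrix A)}

end LocalGlobal

/-! ### Minors, reduction modulo `p`, and completion to an invertible matrix. -/

namespace LocalGlobal

open Matrix

/-! A matrix lies in `U_p` exactly when its rows are dependent modulo `p`. Counting independent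
`n`-tuples in `F_p^m` gives `s_p = 1 - ∏ (1 - p^{-(m-i)}) ≤ n / p²`, a summable sequence because `n
< m`. An integer matrix lying in no `U_p` has minors generating the unit ideal, hence a right
inverse, hence a completion in `GL_m(ℤ)`.

The analytic difficulty is to exchange the sum over primes with the limit in `H`. The primes are cut
at `2H`. For `p ≤ 2H` the proportion of the box lying in `U_p` is at most `2^{nm} s_p`
(`boxProportion_reduce_le`), so dominated convergence applies. For `p > 2H` the average number of
such primes is `O(1/H)` (`exists_sum_largeCount_le`). Indeed a nonzero minor has boundedly many
prime divisors above `2H`. If `p` divides all minors, then some column `j` among the first `n + 1`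
satisfies modulo `p` a row relation found on the other `n`. That relation determines one entry of
column `j` modulo `p`, hence at most one value in `[-H, H[`. Matrices with a vanishing minor form a
proportion `O(1/H)` of the box.

The same split bounds the tail. Together with the Chinese remainder theorem, it gives `R` the
density `∏ (1 - s_p) = ∏ 1/ζ(m-i) < 1`. Since `P(A)` is empty on `R` and `I` has density zero, the
restricted mean is `μ` divided by the density of the complement of `R`. -/

/-- The rows of a matrix over a field are linearly independent if and only if some maximal minor
does not vanish. -/
theorem linearIndependent_row_iff_exists_rowMinor_ne_zero {K : Type} [Field K] {n m : ℕ}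
    (A : Matrix (Fin n) (Fin m) K) :
    LinearIndependent K A.row ↔ ∃ c : Fin n ↪o Fin m, rowMinor A c ≠ 0 := by
  constructor
  · intro h
    have hr : A.rank = n := by
      rw [A.rank_eq_finrank_span_row, finrank_span_eq_card h, Fintype.card_fin]
    rw [A.rank_eq_finrank_span_cols] at hr
    obtain ⟨κ, a, ha, hspan, hli⟩ := exists_linearIndependent' K A.col
    have : Finite κ := Finite.of_injective a ha
    have : Fintype κ := Fintype.ofFinite κ
    have hκ : Fintype.card κ = n := by
      rw [← finrank_span_eq_card hli, hspan, hr]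
    have hs : (Finset.univ.image a).card = n := by
      rw [Finset.card_image_of_injective _ ha, Finset.card_univ, hκ]
    refine ⟨(Finset.univ.image a).orderEmbOfFin hs, ?_⟩
    set c := (Finset.univ.image a).orderEmbOfFin hs
    have hc : ∀ i, ∃ k, a k = c i := fun i => by
      obtain ⟨k, -, hk⟩ := Finset.mem_image.1 (Finset.orderEmbOfFin_mem (Finset.univ.image a) hs i)
      exact ⟨k, hk⟩
    -- The independent columns `a` spanning the column space are `n` in number; `c` lists them in
    -- increasing order and `e` translates between the two indexings.
    choose e he using hc
    have hinj : Function.Injective e := fun i j hij => by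
      apply c.injective
      rw [← he, ← he, hij]
    have hli' := hli.comp e hinj
    have hcol : LinearIndependent K (A.submatrix id c).col := by
      have : (A.submatrix id c).col = (A.col ∘ a) ∘ e := by
        ext i j
        simp [he]
      rwa [this]
    rw [linearIndependent_cols_iff_isUnit, isUnit_iff_isUnit_det] at hcol
    exact hcol.ne_zero
  · rintro ⟨c, hc⟩
    have hu : IsUnit (A.submatrix id c) := (isUnit_iff_isUnit_det _).2 (Ne.isUnit hc)
    rw [← linearIndependent_rows_iff_isUnit] at hu
    -- Rows that are independent after projection to the columns `c` are independent.
    exact LinearIndependent.of_comp (LinearMap.funLeft K K c) hu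

/-- The families of entries of the `n × m` matrices over `ZMod p` with linearly dependent rows. -/
def singularSet (n m p : ℕ) : Set (Fin n × Fin m → ZMod p) :=
  {A | ∀ c : Fin n ↪o Fin m, rowMinor (toMatrix A) c = 0}

theorem mem_singularSet_iff_not_linearIndependent {n m p : ℕ} [Fact p.Prime]
    {A : Fin n × Fin m → ZMod p} :
    A ∈ singularSet n m p ↔ ¬ LinearIndependent (ZMod p) (toMatrix A).row := by
  rw [linearIndependent_row_iff_exists_rowMinor_ne_zero]
  simp [singularSet]

theorem map_rowMinor {R S : Type} [CommRing R] [CommRing S] (f : R →+* S) {n m : ℕ}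
    (A : Fin n × Fin m → R) (c : Fin n ↪o Fin m) :
    f (rowMinor (toMatrix A) c) = rowMinor (toMatrix fun i => f (A i)) c := by
  rw [rowMinor, RingHom.map_det]
  rfl

theorem mem_minorSystem_atPrime_iff {n m : ℕ} {p : Nat.Primes}
    {A : Fin n × Fin m → ℤ_[(p : ℕ)]} :
    A ∈ (minorSystem n m).atPrime p ↔
      (fun i => PadicInt.toZMod (A i)) ∈ singularSet n m (p : ℕ) := by
  refine forall_congr' fun c => ?_
  rw [← map_rowMinor, ← RingHom.mem_ker, PadicInt.ker_toZMod,
    PadicInt.maximalIdeal_eq_span_p, Ideal.mem_span_singleton]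

theorem minorSystem_mem_some_iff_mem_singularSet {n m : ℕ} {p : Nat.Primes}
    {A : Fin n × Fin m → ℤ} :
    (minorSystem n m).Mem A (some p) ↔
      (fun i => (A i : ZMod (p : ℕ))) ∈ singularSet n m (p : ℕ) := by
  refine mem_minorSystem_atPrime_iff.trans ?_
  simp

theorem minorSystem_mem_some_iff {n m : ℕ} {p : Nat.Primes} {A : Fin n × Fin m → ℤ} :
    (minorSystem n m).Mem A (some p) ↔
      ∀ c : Fin n ↪o Fin m, ((p : ℕ) : ℤ) ∣ rowMinor (toMatrix A) c := by
  rw [minorSystem_mem_some_iff_mem_singularSet]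
  refine forall_congr' fun c => ?_
  rw [← ZMod.intCast_zmod_eq_zero_iff_dvd, ← eq_intCast (Int.castRingHom (ZMod (p : ℕ))),
    map_rowMinor]
  rfl

theorem not_minorSystem_mem_none {n m : ℕ} {A : Fin n × Fin m → ℤ} :
    ¬ (minorSystem n m).Mem A none := fun h => h

theorem mem_places_minorSystem {n m : ℕ} {A : Fin n × Fin m → ℤ} {p : Nat.Primes} :
    some p ∈ (minorSystem n m).places A ↔ (minorSystem n m).Mem A (some p) := Iff.rfl

theorem places_minorSystem_eq_image {n m : ℕ} (A : Fin n × Fin m → ℤ) :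
    (minorSystem n m).places A = some '' {p | (minorSystem n m).Mem A (some p)} := by
  ext ν
  cases ν with
  | none => exact ⟨fun h => (not_minorSystem_mem_none (A := A) h).elim, by simp⟩
  | some p => simp [mem_places_minorSystem]

theorem places_minorSystem_eq_empty_iff {n m : ℕ} {A : Fin n × Fin m → ℤ} :
    (minorSystem n m).places A = ∅ ↔ ∀ p, ¬ (minorSystem n m).Mem A (some p) := by
  rw [places_minorSystem_eq_image, Set.image_eq_empty, Set.eq_empty_iff_forall_notMem]
  rfl

theorem finite_primes_dvd {D : ℤ} (hD : D ≠ 0) : {p : Nat.Primes | ((p : ℕ) : ℤ) ∣ D}.Finite := by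
  refine Set.Finite.of_injOn (f := fun p : Nat.Primes => (p : ℕ)) (t := ↑(D.natAbs.divisors)) ?_
    Subtype.val_injective.injOn (Finset.finite_toSet _)
  intro p hp
  simp only [Finset.mem_coe, Nat.mem_divisors]
  exact ⟨Int.natCast_dvd.1 hp, by simpa using hD⟩

/-- A nonzero integer has finitely many prime divisors, whereas every prime divides zero. -/
theorem mem_exceptional_minorSystem_iff {n m : ℕ} {A : Fin n × Fin m → ℤ} :
    A ∈ (minorSystem n m).exceptional ↔
      ∀ c : Fin n ↪o Fin m, rowMinor (toMatrix A) c = 0 := by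
  rw [System.exceptional, Set.mem_ofPred_eq, places_minorSystem_eq_image,
    Set.infinite_image_iff (Option.some_injective _).injOn]
  constructor
  · intro h c
    by_contra hc
    exact h ((finite_primes_dvd hc).subset fun p hp => minorSystem_mem_some_iff.1 hp c)
  · intro h
    have : {p | (minorSystem n m).Mem A (some p)} = Set.univ := by
      ext p
      simp [minorSystem_mem_some_iff, h]
    rw [this]
    exact Set.infinite_univ

/-- An integer matrix with a right inverse can be completed to an invertible matrix. -/
theorem isRectangularUnimodular_of_mul_eq_one {n m : ℕ} (hnm : n ≤ m)
    {A : Matrix (Fin n) (Fin m) ℤ} {R : Matrix (Fin m) (Fin n) ℤ} (h : A * R = 1) :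
    IsRectangularUnimodular A := by
  have hAR : ∀ w, A.mulVecLin (R.mulVecLin w) = w := fun w => by
    simp [Matrix.mulVec_mulVec, h]
  let K := LinearMap.ker A.mulVecLin
  -- The right inverse splits `A`, so `ℤ^m` is `ℤ^n ⊕ ker A`; the kernel is free of rank `m - n`.
  let e₁ : (Fin m → ℤ) ≃ₗ[ℤ] (Fin n → ℤ) × K :=
    { toFun := fun v => (A.mulVecLin v, ⟨v - R.mulVecLin (A.mulVecLin v), by
        rw [LinearMap.mem_ker, map_sub, hAR, sub_self]⟩)
      map_add' := fun v w => by
        ext <;> (simp [Matrix.mulVec_add]; try abel)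
      map_smul' := fun a v => by
        ext1
        · exact map_smul _ _ _
        · ext1
          simp only [map_smul, Submodule.coe_smul, smul_sub, RingHom.id_apply, Prod.smul_snd]
      invFun := fun x => R.mulVecLin x.1 + x.2
      left_inv := fun v => by simp
      right_inv := fun x => by
        have hx : A.mulVecLin (x.2 : Fin m → ℤ) = 0 := x.2.2
        ext1
        · simp only [map_add, hAR, hx, add_zero]
        · ext1
          simp only [map_add, hAR, hx, add_zero, add_sub_cancel_left] }
  have hfin : Module.finrank ℤ K = m - n := by
    have := e₁.finrank_eq
    rw [Module.finrank_prod] at this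
    simp at this
    omega
  let b : Module.Basis (Fin (m - n)) ℤ K := Module.finBasisOfFinrankEq ℤ K hfin
  -- The `ℤ^n` coordinates are placed first, so the first `n` rows of the matrix of `e` are those of
  -- `A`.
  let e₂ : ((Fin n → ℤ) × K) ≃ₗ[ℤ] (Fin m → ℤ) :=
    (LinearEquiv.prodCongr (LinearEquiv.refl ℤ _) b.equivFun).trans
      ((LinearEquiv.sumArrowLequivProdArrow (Fin n) (Fin (m - n)) ℤ ℤ).symm.trans
        (LinearEquiv.funCongrLeft ℤ ℤ
          ((finCongr (by omega : m = n + (m - n))).trans finSumFinEquiv.symm)))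
  let e := e₁.trans e₂
  refine ⟨hnm, LinearMap.toMatrix' e.toLinearMap, ?_, ?_⟩
  · rw [isUnit_iff_isUnit_det, LinearMap.det_toMatrix']
    exact LinearEquiv.isUnit_det' e
  · intro i j
    rw [LinearMap.toMatrix'_apply]
    have : finSumFinEquiv.symm (finCongr (by omega : m = n + (m - n)) (Fin.castLE hnm i)) =
        Sum.inl i := by
      rw [Equiv.symm_apply_eq]
      rfl
    change Sum.elim (A.mulVecLin (Pi.single j 1)) _
      (finSumFinEquiv.symm (finCongr (by omega : m = n + (m - n)) (Fin.castLE hnm i))) = A i j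
    rw [this]
    simp

/-- No prime divides all minors, so some integer combination of them is `1`. For each `c`, the
adjugate of the submatrix on `c`, padded with zero rows, is a right inverse of `A` up to the factor
`rowMinor A c`; the same combination of these matrices is a right inverse. -/
theorem exists_mul_eq_one_of_forall_prime {n m : ℕ} {A : Matrix (Fin n) (Fin m) ℤ}
    (h : ∀ p : Nat.Primes, ∃ c : Fin n ↪o Fin m, ¬ ((p : ℕ) : ℤ) ∣ rowMinor A c) :
    ∃ R : Matrix (Fin m) (Fin n) ℤ, A * R = 1 := by
  have hspan : Ideal.span (Set.range (rowMinor A)) = ⊤ := by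
    by_contra hne
    obtain ⟨M, hM, hle⟩ := Ideal.exists_le_maximal _ hne
    obtain ⟨g, hg⟩ := IsPrincipalIdealRing.principal M
    have hgu : ¬ IsUnit g := fun hu => hM.ne_top (by
      rw [hg]; exact Ideal.span_singleton_eq_top.2 hu)
    -- This includes `g = 0`, which every prime divides.
    obtain ⟨p, hp, hpg⟩ := Nat.exists_prime_and_dvd (n := g.natAbs)
      (fun h1 => hgu (Int.isUnit_iff_natAbs_eq.2 h1))
    obtain ⟨c, hc⟩ := h ⟨p, hp⟩
    apply hc
    have hmem : rowMinor A c ∈ M := hle (Ideal.subset_span ⟨c, rfl⟩)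
    rw [hg] at hmem
    exact (Int.natCast_dvd.2 hpg).trans (Ideal.mem_span_singleton.1 hmem)
  have h1 : (1 : ℤ) ∈ Ideal.span (Set.range (rowMinor A)) := hspan ▸ Submodule.mem_top
  obtain ⟨x, hx⟩ := (Submodule.mem_span_range_iff_exists_fun ℤ).1 h1
  refine ⟨∑ c, x c • ((1 : Matrix (Fin m) (Fin m) ℤ).submatrix id c *
    (A.submatrix id c).adjugate), ?_⟩
  have key : ∀ c : Fin n ↪o Fin m, A * ((1 : Matrix (Fin m) (Fin m) ℤ).submatrix id c *
      (A.submatrix id c).adjugate) = rowMinor A c • 1 := fun c => by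
    rw [← Matrix.mul_assoc, show A * (1 : Matrix (Fin m) (Fin m) ℤ).submatrix id c = A.submatrix id c by
      ext i j; simp [Matrix.mul_apply, Matrix.one_apply], Matrix.mul_adjugate]
    rfl
  simp_rw [Matrix.mul_sum, Matrix.mul_smul, key, smul_smul, ← Finset.sum_smul]
  simp only [smul_eq_mul] at hx
  rw [hx, one_smul]

theorem mem_unimodularSet_iff {n m : ℕ} (hnm : n ≤ m) {A : Fin n × Fin m → ℤ} :
    A ∈ unimodularSet n m ↔ (minorSystem n m).places A = ∅ := by
  rw [places_minorSystem_eq_empty_iff]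
  constructor
  · rintro ⟨_, B, hB, hBA⟩ p hp
    rw [minorSystem_mem_some_iff_mem_singularSet, mem_singularSet_iff_not_linearIndependent] at hp
    apply hp
    -- Invertibility survives reduction modulo `p`, so the rows of `B`, and in particular the first
    -- `n`, are independent there.
    have hB' : IsUnit (B.map (Int.castRingHom (ZMod (p : ℕ)))) :=
      hB.map (Int.castRingHom (ZMod (p : ℕ))).mapMatrix
    rw [← linearIndependent_rows_iff_isUnit] at hB'
    convert hB'.comp (Fin.castLE hnm) (Fin.castLE_injective hnm) using 1
    ext i j
    simp [hBA, toMatrix]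
  · intro h
    obtain ⟨R, hR⟩ := exists_mul_eq_one_of_forall_prime (A := toMatrix A) fun p => by
      simpa [minorSystem_mem_some_iff] using h p
    exact isRectangularUnimodular_of_mul_eq_one hnm hR

end LocalGlobal

/-! ### Counting in boxes: vanishing minors and large primes. -/

namespace LocalGlobal

open Matrix Finset

section Box

variable {ι : Type} [Fintype ι] [DecidableEq ι]

theorem mem_box {A : ι → ℤ} {H : ℕ} : A ∈ box ι H ↔ ∀ i, A i ∈ Ico (-(H : ℤ)) (H : ℤ) :=
  Fintype.mem_piFinset

theorem card_Ico_neg_self (H : ℕ) : #(Ico (-(H : ℤ)) (H : ℤ)) = 2 * H := by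
  rw [Int.card_Ico]
  omega

theorem card_box (H : ℕ) : #(box ι H) = (2 * H) ^ Fintype.card ι := by
  simp [box, Fintype.card_piFinset, card_Ico_neg_self, -Int.card_Ico]

theorem update_mem_box {A : ι → ℤ} {H : ℕ} (hA : A ∈ box ι H) (e : ι) {x : ℤ}
    (hx : x ∈ Ico (-(H : ℤ)) (H : ℤ)) : Function.update A e x ∈ box ι H := by
  rw [mem_box] at hA ⊢
  intro i
  rcases eq_or_ne i e with rfl | h
  · simpa using hx
  · simpa [h] using hA i

/-- Averaging over one coordinate does not change the sum over a box. -/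
theorem sum_box_sum_update (H : ℕ) (e : ι) (g : (ι → ℤ) → ℕ) :
    ∑ A ∈ box ι H, ∑ x ∈ Ico (-(H : ℤ)) (H : ℤ), g (Function.update A e x) =
      2 * H * ∑ A ∈ box ι H, g A := by
  have h : ∑ A ∈ box ι H, ∑ x ∈ Ico (-(H : ℤ)) (H : ℤ), g A = 2 * H * ∑ A ∈ box ι H, g A := by
    simp_rw [sum_const, card_Ico_neg_self, smul_eq_mul, mul_sum]
  rw [← h, ← sum_product', ← sum_product']
  -- The involution exchanges `x` with the coordinate `e` of `A`.
  refine sum_bij' (fun z _ => (Function.update z.1 e z.2, z.1 e))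
    (fun z _ => (Function.update z.1 e z.2, z.1 e)) ?_ ?_ ?_ ?_ ?_
  · intro z hz
    rw [mem_product] at hz ⊢
    exact ⟨update_mem_box hz.1 e hz.2, mem_box.1 hz.1 e⟩
  · intro z hz
    rw [mem_product] at hz ⊢
    exact ⟨update_mem_box hz.1 e hz.2, mem_box.1 hz.1 e⟩
  · intro z _
    simp
  · intro z _
    simp
  · intro z _
    rfl

/-- A bound on every line in direction `e` saves a factor `2H` over the box. Multiplying by `2H`
instead of dividing keeps the estimate in `ℕ`. -/
theorem mul_sum_box_le_of_sum_update_le {H : ℕ} (e : ι) {g : (ι → ℤ) → ℕ} {K : ℕ}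
    (h : ∀ A ∈ box ι H, ∑ x ∈ Ico (-(H : ℤ)) (H : ℤ), g (Function.update A e x) ≤ K) :
    2 * H * ∑ A ∈ box ι H, g A ≤ K * (2 * H) ^ Fintype.card ι := by
  rw [← sum_box_sum_update H e g, mul_comm K, ← card_box (ι := ι), ← smul_eq_mul]
  exact sum_le_card_nsmul _ _ _ h

end Box

section Vanishing

variable {ρ γ : Type} [Fintype ρ] [DecidableEq ρ] [Fintype γ] [DecidableEq γ]

/-- The number of integer points of the box at which a given minor of size `k` vanishes. -/
theorem card_box_det_eq_zero_le (H : ℕ) {k : ℕ} {r : Fin k → ρ} {c : Fin k → γ}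
    (hr : Function.Injective r) (hc : Function.Injective c) :
    2 * H * #{A ∈ box (ρ × γ) H | (Matrix.of fun i j => A (r i, c j)).det = 0} ≤
      k * (2 * H) ^ Fintype.card (ρ × γ) := by
  induction k with
  | zero => simp
  | succ k ih =>
    have hr' := hr.comp (Fin.succ_injective k)
    have hc' := hc.comp (Fin.succ_injective k)
    -- Either the minor without the first row and column vanishes, which the induction counts, or it
    -- does not. Arbitrary injections `r` and `c` let the induction pass to it.
    have hsub : ({A ∈ box (ρ × γ) H | (Matrix.of fun i j => A (r i, c j)).det = 0}) ⊆
        {A ∈ box (ρ × γ) H |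
            (Matrix.of fun i j => A ((r ∘ Fin.succ) i, (c ∘ Fin.succ) j)).det = 0} ∪
        {A ∈ box (ρ × γ) H | (Matrix.of fun i j => A (r i, c j)).det = 0 ∧
            (Matrix.of fun i j => A ((r ∘ Fin.succ) i, (c ∘ Fin.succ) j)).det ≠ 0} := by
      intro A
      simp only [mem_union, mem_filter]
      tauto
    -- The determinant is affine in its top left entry, with slope the smaller minor; a nonzero
    -- slope leaves at most one root on each line.
    have hdet : ∀ (A : ρ × γ → ℤ) (x : ℤ),
        (Matrix.of fun i j => Function.update A (r 0, c 0) x (r i, c j)).det =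
          x * (Matrix.of fun i j => A ((r ∘ Fin.succ) i, (c ∘ Fin.succ) j)).det +
          (Matrix.of fun i j => Function.update A (r 0, c 0) 0 (r i, c j)).det := by
      intro A x
      have hsucc : ∀ (y : ℤ) (j : Fin (k + 1)),
          (Matrix.of fun i j => Function.update A (r 0, c 0) y (r i, c j)).submatrix
            Fin.succ j.succAbove =
          (Matrix.of fun i j => A (r i, c j)).submatrix Fin.succ j.succAbove := by
        intro y j
        ext a b
        have : (r a.succ, c (j.succAbove b)) ≠ (r 0, c 0) := fun h =>
          Fin.succ_ne_zero a (hr (Prod.ext_iff.1 h).1)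
        simp [this]
      have h0 : ∀ (y : ℤ) (j : Fin k),
          Function.update A (r 0, c 0) y (r 0, c j.succ) = A (r 0, c j.succ) := by
        intro y j
        have : (r 0, c j.succ) ≠ (r 0, c 0) := fun h =>
          Fin.succ_ne_zero j (hc (Prod.ext_iff.1 h).2)
        simp [this]
      rw [det_succ_row_zero, det_succ_row_zero, Fin.sum_univ_succ, Fin.sum_univ_succ]
      simp only [hsucc, of_apply, h0, Function.update_self]
      simp only [Fin.val_zero, pow_zero, one_mul, zero_mul, mul_zero, zero_add]
      rfl
    have hstep : 2 * H * #{A ∈ box (ρ × γ) H | (Matrix.of fun i j => A (r i, c j)).det = 0 ∧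
        (Matrix.of fun i j => A ((r ∘ Fin.succ) i, (c ∘ Fin.succ) j)).det ≠ 0} ≤
        1 * (2 * H) ^ Fintype.card (ρ × γ) := by
      rw [card_filter]
      refine mul_sum_box_le_of_sum_update_le (r 0, c 0) fun A _ => ?_
      rw [← card_filter, card_le_one]
      intro x hx y hy
      have hmin : ∀ z : ℤ, (Matrix.of fun i j =>
          Function.update A (r 0, c 0) z ((r ∘ Fin.succ) i, (c ∘ Fin.succ) j)) =
          Matrix.of fun i j => A ((r ∘ Fin.succ) i, (c ∘ Fin.succ) j) := by
        intro z
        ext a b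
        have : (r a.succ, c b.succ) ≠ (r 0, c 0) := fun h =>
          Fin.succ_ne_zero a (hr (Prod.ext_iff.1 h).1)
        simp [this]
      rw [mem_filter, hmin, hdet] at hx hy
      have := hx.2.1.trans hy.2.1.symm
      exact mul_right_cancel₀ hx.2.2 (add_right_cancel this)
    calc _ ≤ _ := Nat.mul_le_mul_left _ ((card_le_card hsub).trans (card_union_le _ _))
      _ = _ := mul_add _ _ _
      _ ≤ _ := add_le_add (ih hr' hc') hstep
      _ = _ := by ring

end Vanishing

/-! ### Primes above `2H` dividing all minors. -/

section LargePrimes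

open Classical in
/-- The primes greater than `2 * H` that divide `D`; the empty set if `D = 0`. -/
noncomputable def largePrimeDivisors (H : ℕ) (D : ℤ) : Finset Nat.Primes :=
  if h : D ≠ 0 then (finite_primes_dvd h).toFinset.filter (fun p => 2 * H < (p : ℕ)) else ∅

theorem mem_largePrimeDivisors {H : ℕ} {D : ℤ} {p : Nat.Primes} :
    p ∈ largePrimeDivisors H D ↔ D ≠ 0 ∧ ((p : ℕ) : ℤ) ∣ D ∧ 2 * H < (p : ℕ) := by
  by_cases h : D = 0 <;> simp [largePrimeDivisors, h]

/-- The product of these `k` primes divides `D`, so `(2H)^k ≤ n! H^n`. If `k > n + n!`, cancelling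
`H^n` leaves `2^k ≤ n!`, against `k < 2^k`. The bound does not depend on `H`. -/
theorem card_largePrimeDivisors_le {H : ℕ} (hH : 0 < H) {D : ℤ} {n : ℕ}
    (hD : D.natAbs ≤ n.factorial * H ^ n) :
    #(largePrimeDivisors H D) ≤ n + n.factorial := by
  by_cases h0 : D = 0
  · simp [largePrimeDivisors, h0]
  by_contra! hlt
  set k := #(largePrimeDivisors H D) with hk
  have hdvd : ∏ p ∈ (largePrimeDivisors H D).map ⟨fun p : Nat.Primes => (p : ℕ), Subtype.val_injective⟩, p ∣ D.natAbs := by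
    refine Finset.prod_primes_dvd _ ?_ ?_
    · intro p hp
      obtain ⟨q, -, rfl⟩ := mem_map.1 hp
      exact q.2.prime
    · intro p hp
      obtain ⟨q, hq, rfl⟩ := mem_map.1 hp
      exact Int.natCast_dvd.1 (mem_largePrimeDivisors.1 hq).2.1
  rw [prod_map] at hdvd
  have h1 : (2 * H) ^ k ≤ n.factorial * H ^ n := by
    refine le_trans ?_ ((Nat.le_of_dvd (Int.natAbs_pos.2 h0) hdvd).trans hD)
    rw [hk, ← prod_const]
    exact prod_le_prod' fun p hp => (mem_largePrimeDivisors.1 hp).2.2.le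
  have h2 : 2 ^ k * H ^ n ≤ n.factorial * H ^ n := by
    refine le_trans ?_ h1
    rw [mul_pow]
    exact Nat.mul_le_mul_left _ (Nat.pow_le_pow_right hH (by omega))
  have h3 : 2 ^ k ≤ n.factorial := Nat.le_of_mul_le_mul_right h2 (by positivity)
  have := Nat.lt_two_pow_self (n := k)
  omega

theorem natAbs_rowMinor_le {n m H : ℕ} {A : Fin n × Fin m → ℤ}
    (hA : A ∈ box (Fin n × Fin m) H) (c : Fin n ↪o Fin m) :
    (rowMinor (toMatrix A) c).natAbs ≤ n.factorial * H ^ n := by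
  have := det_le (A := (toMatrix A).submatrix id c) (abv := AbsoluteValue.abs) (x := (H : ℤ))
    fun i j => by
      have := mem_box.1 hA (i, c j)
      rw [mem_Ico] at this
      exact abs_le.2 ⟨this.1, this.2.le⟩
  rw [Fintype.card_fin, nsmul_eq_mul, AbsoluteValue.abs_apply, ← Int.natCast_natAbs] at this
  exact_mod_cast this

open Classical in
/-- A nonzero vector in the left kernel of a singular matrix. -/
noncomputable def leftKernelVector {K : Type} [Field K] {n : ℕ} (M : Matrix (Fin n) (Fin n) K) :
    Fin n → K :=
  if h : ∃ v ≠ 0, v ᵥ* M = 0 then h.choose else 0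

theorem leftKernelVector_spec {K : Type} [Field K] {n : ℕ} {M : Matrix (Fin n) (Fin n) K}
    (hM : M.det = 0) : leftKernelVector M ≠ 0 ∧ leftKernelVector M ᵥ* M = 0 := by
  have h := exists_vecMul_eq_zero_iff.2 hM
  rw [leftKernelVector, dif_pos h]
  exact h.choose_spec

/-- If all maximal minors of an `n × (n + 1)` matrix vanish, then some column is annihilated by
every vector that annihilates all the other columns. -/
theorem exists_col_dependent {K : Type} [Field K] {n : ℕ} (a : Fin (n + 1) → Fin n → K) :
    ∃ j, ∀ f : Fin n → K, (∀ i : Fin n, f ⬝ᵥ a (j.succAbove i) = 0) → f ⬝ᵥ a j = 0 := by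
  have hdep : ¬ LinearIndependent K a := fun h => by
    have := h.fintype_card_le_finrank
    simp at this
  -- The `n + 1` vectors in `K^n` satisfy a relation `t`; at an index `j` with `t j ≠ 0`, applying
  -- `f` isolates the `j`-th term.
  obtain ⟨t, ht, j, hj⟩ := Fintype.not_linearIndependent_iff.1 hdep
  refine ⟨j, fun f hf => ?_⟩
  have h := congrArg (fun v => f ⬝ᵥ v) ht
  simp only [dotProduct_sum, dotProduct_smul, dotProduct_zero] at h
  rw [Fin.sum_univ_succAbove _ j] at h
  simpa [hf, hj] using h

/-- The columns other than the `j`-th among the first `n + 1`. -/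
def omitCol {n m : ℕ} (hnm : n < m) (j : Fin (n + 1)) : Fin n ↪o Fin m :=
  (Fin.succAboveOrderEmb j).trans (Fin.castLEOrderEmb hnm)

theorem omitCol_apply {n m : ℕ} (hnm : n < m) (j : Fin (n + 1)) (i : Fin n) :
    omitCol hnm j i = Fin.castLE hnm (j.succAbove i) := rfl

/-- The reduction modulo `p` of the square submatrix on the columns `c`. -/
def redSubmatrix {n m : ℕ} (p : ℕ) (A : Fin n × Fin m → ℤ) (c : Fin n ↪o Fin m) :
    Matrix (Fin n) (Fin n) (ZMod p) :=
  Matrix.of fun i j => (A (i, c j) : ZMod p)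

theorem det_redSubmatrix {n m : ℕ} (p : ℕ) (A : Fin n × Fin m → ℤ) (c : Fin n ↪o Fin m) :
    (redSubmatrix p A c).det = ((rowMinor (toMatrix A) c : ℤ) : ZMod p) := by
  rw [rowMinor, ← eq_intCast (Int.castRingHom (ZMod p)), RingHom.map_det]
  rfl

open Classical in
/-- The large primes `p` dividing the minor on `omitCol hnm j` for which the chosen linear relation
modulo `p` between the rows of that minor involves the row `k` and holds for the column `j`. -/
noncomputable def relationPrimes {n m : ℕ} (hnm : n < m) (j : Fin (n + 1)) (k : Fin n) (H : ℕ)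
    (A : Fin n × Fin m → ℤ) : Finset Nat.Primes :=
  (largePrimeDivisors H (rowMinor (toMatrix A) (omitCol hnm j))).filter fun p =>
    leftKernelVector (redSubmatrix (p : ℕ) A (omitCol hnm j)) k ≠ 0 ∧
      leftKernelVector (redSubmatrix (p : ℕ) A (omitCol hnm j)) ⬝ᵥ
        (fun i => (A (i, Fin.castLE hnm j) : ZMod (p : ℕ))) = 0

/-- The index `j` comes from `exists_col_dependent` modulo `p`, and `k` is any nonzero coordinate of
the kernel vector of the minor omitting column `j`. -/
theorem exists_mem_relationPrimes {n m : ℕ} (hnm : n < m) {H : ℕ} {A : Fin n × Fin m → ℤ}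
    (hA : ∀ c : Fin n ↪o Fin m, rowMinor (toMatrix A) c ≠ 0) {p : Nat.Primes}
    (hp : 2 * H < (p : ℕ)) (hpA : (minorSystem n m).Mem A (some p)) :
    ∃ j k, p ∈ relationPrimes hnm j k H A := by
  rw [minorSystem_mem_some_iff] at hpA
  obtain ⟨j, hj⟩ := exists_col_dependent
    (fun j i => (A (i, Fin.castLE hnm j) : ZMod (p : ℕ)))
  have hdet : (redSubmatrix (p : ℕ) A (omitCol hnm j)).det = 0 := by
    rw [det_redSubmatrix, ZMod.intCast_zmod_eq_zero_iff_dvd]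
    exact hpA _
  obtain ⟨hne, hker⟩ := leftKernelVector_spec hdet
  obtain ⟨k, hk⟩ := Function.ne_iff.1 hne
  refine ⟨j, k, mem_filter.2 ⟨mem_largePrimeDivisors.2 ⟨hA _, hpA _, hp⟩, hk, hj _ fun i => ?_⟩⟩
  exact congrFun hker i

/-- Varying the entry `(k, j)` changes neither the minor omitting column `j`, nor its large prime
divisors, nor the chosen kernel vectors. For each such prime, the relation determines the entry
modulo `p`, as the coefficient at `k` is nonzero; since `p > 2H`, at most one value in the interval
remains. -/
theorem sum_card_relationPrimes_le {n m : ℕ} (hnm : n < m) (j : Fin (n + 1)) (k : Fin n) {H : ℕ}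
    (hH : 0 < H) :
    2 * H * ∑ A ∈ box (Fin n × Fin m) H, #(relationPrimes hnm j k H A) ≤
      (n + n.factorial) * (2 * H) ^ Fintype.card (Fin n × Fin m) := by
  classical
  set e : Fin n × Fin m := (k, Fin.castLE hnm j)
  refine mul_sum_box_le_of_sum_update_le e fun A hA => ?_
  have hoff : ∀ x i l, Function.update A e x (i, omitCol hnm j l) = A (i, omitCol hnm j l) := by
    intro x i l
    have : (i, omitCol hnm j l) ≠ e := fun h => by
      have := (Prod.ext_iff.1 h).2
      rw [omitCol_apply] at this
      exact Fin.succAbove_ne j l (Fin.castLE_injective hnm this)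
    rw [Function.update_of_ne this]
  have hminor : ∀ x, rowMinor (toMatrix (Function.update A e x)) (omitCol hnm j) =
      rowMinor (toMatrix A) (omitCol hnm j) := by
    intro x
    refine congrArg Matrix.det ?_
    ext i l
    exact hoff x i l
  have hred : ∀ x p, redSubmatrix p (Function.update A e x) (omitCol hnm j) =
      redSubmatrix p A (omitCol hnm j) := by
    intro x p
    ext i l
    simp [redSubmatrix, hoff]
  refine le_trans ?_ (card_largePrimeDivisors_le hH (natAbs_rowMinor_le hA (omitCol hnm j)))
  simp only [relationPrimes, hminor, hred, card_filter]
  rw [sum_comm, card_eq_sum_ones]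
  refine sum_le_sum fun p hp => ?_
  rw [← card_filter, card_le_one]
  intro x hx y hy
  rw [mem_filter] at hx hy
  obtain ⟨hx, hk, hx'⟩ := hx
  obtain ⟨hy, -, hy'⟩ := hy
  set f := leftKernelVector (redSubmatrix (p : ℕ) A (omitCol hnm j))
  have hsplit : ∀ z : ℤ, f ⬝ᵥ (fun i => (Function.update A e z (i, Fin.castLE hnm j) :
      ZMod (p : ℕ))) = f k * z + ∑ i ∈ univ.erase k, f i * A (i, Fin.castLE hnm j) := by
    intro z
    rw [dotProduct, ← add_sum_erase _ _ (mem_univ k)]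
    congr 1
    · simp [e]
    · refine sum_congr rfl fun i hi => ?_
      have : (i, Fin.castLE hnm j) ≠ e := fun h => (mem_erase.1 hi).1 (Prod.ext_iff.1 h).1
      rw [Function.update_of_ne this]
  rw [hsplit] at hx' hy'
  have hxy : (x : ZMod (p : ℕ)) = y :=
    mul_left_cancel₀ hk (add_right_cancel (hx'.trans hy'.symm))
  rw [ZMod.intCast_eq_intCast_iff_dvd_sub] at hxy
  have hpH := (mem_largePrimeDivisors.1 hp).2.2
  rw [mem_Ico] at hx hy
  have h0 : y - x = 0 := Int.eq_zero_of_abs_lt_dvd hxy (by rw [abs_lt]; constructor <;> omega)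
  omega

/-- The number of primes `p > 2 * H` with `A ∈ U_p`. -/
noncomputable def largeCount {n m : ℕ} (H : ℕ) (A : Fin n × Fin m → ℤ) : ℕ :=
  {p : Nat.Primes | 2 * H < (p : ℕ) ∧ (minorSystem n m).Mem A (some p)}.ncard

/-- If no minor vanishes, every large prime comes from a relation. Otherwise some minor is still
nonzero, since `A` is not exceptional; it has at most `n + n!` large prime divisors, and the term of
a vanishing minor `c₀` pays for them. -/
theorem largeCount_le {n m : ℕ} (hnm : n < m) {H : ℕ} (hH : 0 < H) {A : Fin n × Fin m → ℤ}
    (hA : A ∈ box (Fin n × Fin m) H) (hI : A ∉ (minorSystem n m).exceptional) :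
    largeCount H A ≤ ∑ j, ∑ k, #(relationPrimes hnm j k H A) +
      ∑ c : Fin n ↪o Fin m, (n + n.factorial) * if rowMinor (toMatrix A) c = 0 then 1 else 0 := by
  classical
  by_cases hall : ∀ c : Fin n ↪o Fin m, rowMinor (toMatrix A) c ≠ 0
  · refine le_trans ?_ (Nat.le_add_right _ _)
    have hsub : {p : Nat.Primes | 2 * H < (p : ℕ) ∧ (minorSystem n m).Mem A (some p)} ⊆
        ↑(univ.biUnion fun j => univ.biUnion fun k => relationPrimes hnm j k H A) := by
      intro p hp
      simpa using exists_mem_relationPrimes hnm hall hp.1 hp.2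
    refine (Set.ncard_le_ncard hsub (finite_toSet _)).trans ?_
    rw [Set.ncard_coe_finset]
    exact card_biUnion_le.trans (sum_le_sum fun j _ => card_biUnion_le)
  · push Not at hall
    obtain ⟨c₀, hc₀⟩ := hall
    rw [mem_exceptional_minorSystem_iff] at hI
    push Not at hI
    obtain ⟨c, hc⟩ := hI
    refine le_trans ?_ (Nat.le_add_left _ _)
    have hsub : {p : Nat.Primes | 2 * H < (p : ℕ) ∧ (minorSystem n m).Mem A (some p)} ⊆
        ↑(largePrimeDivisors H (rowMinor (toMatrix A) c)) := by
      intro p hp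
      exact mem_coe.2 (mem_largePrimeDivisors.2 ⟨hc, minorSystem_mem_some_iff.1 hp.2 c, hp.1⟩)
    refine (Set.ncard_le_ncard hsub (finite_toSet _)).trans ?_
    rw [Set.ncard_coe_finset]
    refine (card_largePrimeDivisors_le hH (natAbs_rowMinor_le hA c)).trans ?_
    refine le_trans ?_ (single_le_sum (fun _ _ => Nat.zero_le _) (mem_univ c₀))
    simp [hc₀]

open Classical in
theorem mul_card_box_rowMinor_eq_zero_le {n m : ℕ} (H : ℕ) (c : Fin n ↪o Fin m) :
    2 * H * #{A ∈ box (Fin n × Fin m) H | rowMinor (toMatrix A) c = 0} ≤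
      n * (2 * H) ^ Fintype.card (Fin n × Fin m) := by
  have := card_box_det_eq_zero_le H (r := fun i : Fin n => i) (c := c) Function.injective_id
    c.injective
  convert this using 5
  rfl

open Classical in
/-- On average over the box of size `H`, few primes greater than `2 * H` divide all minors. -/
theorem exists_sum_largeCount_le {n m : ℕ} (hnm : n < m) : ∃ C : ℕ, ∀ H : ℕ, 0 < H →
    2 * H * ∑ A ∈ box (Fin n × Fin m) H with A ∉ (minorSystem n m).exceptional, largeCount H A ≤
      C * (2 * H) ^ Fintype.card (Fin n × Fin m) := by
  set K := n + n.factorial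
  -- There are `(n + 1) * n` pairs `(j, k)`, each costing `K`; each minor vanishes on a proportion
  -- at most `n / (2H)` and carries weight `K`.
  refine ⟨(n + 1) * (n * K) + Fintype.card (Fin n ↪o Fin m) * (K * n), fun H hH => ?_⟩
  set N := (2 * H) ^ Fintype.card (Fin n × Fin m)
  have h1 : ∑ A ∈ box (Fin n × Fin m) H with A ∉ (minorSystem n m).exceptional, largeCount H A ≤
      ∑ A ∈ box (Fin n × Fin m) H, (∑ j, ∑ k, #(relationPrimes hnm j k H A) +
        ∑ c : Fin n ↪o Fin m, K * if rowMinor (toMatrix A) c = 0 then 1 else 0) := by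
    refine le_trans (sum_le_sum fun A hA => ?_) (sum_le_sum_of_subset (filter_subset _ _))
    rw [mem_filter] at hA
    exact largeCount_le hnm hH hA.1 hA.2
  refine (Nat.mul_le_mul_left _ h1).trans ?_
  rw [sum_add_distrib, mul_add, add_mul]
  refine add_le_add ?_ ?_
  · rw [sum_comm, mul_sum]
    refine (sum_le_card_nsmul univ _ ((n * K) * N) fun j _ => ?_).trans_eq (by simp; ring)
    rw [sum_comm, mul_sum]
    refine (sum_le_card_nsmul univ _ (K * N) fun k _ => ?_).trans_eq (by simp; ring)
    exact sum_card_relationPrimes_le hnm j k hH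
  · rw [sum_comm, mul_sum]
    refine (sum_le_card_nsmul univ _ ((K * n) * N) fun c _ => ?_).trans_eq (by simp; ring)
    rw [← mul_sum, ← card_filter, mul_left_comm, mul_assoc K n N]
    exact Nat.mul_le_mul_left _ (mul_card_box_rowMinor_eq_zero_le H c)

end LargePrimes

end LocalGlobal

/-! ### Densities of congruence conditions. -/

namespace LocalGlobal

open Finset Filter Topology

section Residues

variable {ι : Type} [Fintype ι] [DecidableEq ι]

/-- The reduction of an integer point modulo `q`. -/
def reduce (q : ℕ) (A : ι → ℤ) : ι → ZMod q := fun i => (A i : ZMod q)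

/-- The number of integers in `[-H, H[` in a given residue class modulo `q`. -/
noncomputable def residueCount (q : ℕ) (a : ZMod q) (H : ℕ) : ℕ :=
  #{x ∈ Ico (-(H : ℤ)) (H : ℤ) | ((x : ℤ) : ZMod q) = a}

/-- The count is a difference of two ceilings whose arguments differ by `2H / q`. -/
theorem abs_residueCount_sub_le {q : ℕ} (hq : 0 < q) (a : ZMod q) (H : ℕ) :
    |(residueCount q a H : ℝ) - 2 * H / q| ≤ 1 := by
  obtain ⟨v, rfl⟩ := ZMod.intCast_surjective a
  have hcard := Int.Ico_filter_modEq_card (-(H : ℤ)) (H : ℤ) (Int.natCast_pos.2 hq) v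
  have heq : residueCount q (v : ZMod q) H = #{x ∈ Ico (-(H : ℤ)) (H : ℤ) | x ≡ v [ZMOD q]} := by
    simp_rw [residueCount, ZMod.intCast_eq_intCast_iff]
  rw [← heq] at hcard
  have hqQ : (0 : ℚ) < q := by exact_mod_cast hq
  set u : ℚ := (((H : ℤ) : ℚ) - v) / ((q : ℤ) : ℚ)
  set w : ℚ := ((((-(H : ℤ)) : ℤ) : ℚ) - v) / ((q : ℤ) : ℚ)
  have huw : u - w = 2 * H / q := by
    simp only [u, w]
    push_cast
    ring
  have hle : w ≤ u := by
    have : 0 ≤ u - w := by rw [huw]; positivity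
    linarith
  rw [max_eq_left (sub_nonneg.2 (Int.ceil_mono hle))] at hcard
  have hQ : (residueCount q (v : ZMod q) H : ℚ) = ⌈u⌉ - ⌈w⌉ := by exact_mod_cast hcard
  have hQ' : |(residueCount q (v : ZMod q) H : ℚ) - 2 * H / q| ≤ 1 := by
    rw [hQ, ← huw, abs_le]
    have := Int.le_ceil u
    have := Int.le_ceil w
    have := Int.ceil_lt_add_one u
    have := Int.ceil_lt_add_one w
    constructor <;> linarith
  have := (Rat.cast_le (K := ℝ)).2 hQ'
  push_cast at this
  exact this

theorem abs_residueCount_div_sub_le {q : ℕ} (hq : 0 < q) (a : ZMod q) {H : ℕ} (hH : 0 < H) :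
    |(residueCount q a H : ℝ) / (2 * H) - 1 / q| ≤ 1 / (2 * H) := by
  have hH' : (0 : ℝ) < 2 * H := by positivity
  have : (residueCount q a H : ℝ) / (2 * H) - 1 / q =
      ((residueCount q a H : ℝ) - 2 * H / q) / (2 * H) := by
    field_simp
  rw [this, abs_div, abs_of_pos hH']
  exact div_le_div_of_nonneg_right (abs_residueCount_sub_le hq a H) hH'.le

theorem tendsto_const_div_two_mul (C : ℝ) :
    Tendsto (fun H : ℕ => C / (2 * (H : ℝ))) atTop (𝓝 0) :=
  tendsto_const_nhds.div_atTop (tendsto_natCast_atTop_atTop.const_mul_atTop two_pos)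

theorem tendsto_residueCount_div {q : ℕ} (hq : 0 < q) (a : ZMod q) :
    Tendsto (fun H : ℕ => (residueCount q a H : ℝ) / (2 * H)) atTop (𝓝 (1 / q)) := by
  rw [tendsto_iff_norm_sub_tendsto_zero]
  refine tendsto_of_tendsto_of_tendsto_of_le_of_le' tendsto_const_nhds
    (tendsto_const_div_two_mul 1) (Eventually.of_forall fun _ => norm_nonneg _) ?_
  filter_upwards [eventually_gt_atTop 0] with H hH
  exact abs_residueCount_div_sub_le hq a hH

/-- The proportion of a set of residues. -/
noncomputable def residueDensity (q : ℕ) (S : Set (ι → ZMod q)) : ℝ :=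
  (S.ncard : ℝ) / (q : ℝ) ^ Fintype.card ι

theorem residueDensity_nonneg {κ : Type} [Fintype κ] (q : ℕ) (S : Set (κ → ZMod q)) : 0 ≤ residueDensity q S := by
  unfold residueDensity
  positivity

-- The box is a product of intervals, so the count for a fixed residue vector factors over the
-- coordinates.
open Classical in
theorem boxProportion_reduce_eq {q : ℕ} [NeZero q] (S : Set (ι → ZMod q)) (H : ℕ) :
    boxProportion {A : ι → ℤ | reduce q A ∈ S} H =
      ∑ a : ι → ZMod q with a ∈ S, ∏ i, (residueCount q (a i) H : ℝ) / (2 * H) := by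
  have hfib : #{A ∈ box ι H | A ∈ {A : ι → ℤ | reduce q A ∈ S}} =
      ∑ a : ι → ZMod q with a ∈ S, ∏ i, residueCount q (a i) H := by
    rw [card_eq_sum_card_fiberwise (f := reduce q) (t := {a | a ∈ S})]
    · refine sum_congr rfl fun a ha => ?_
      simp_rw [residueCount]
      rw [← Fintype.card_piFinset]
      congr 1
      ext A
      simp only [mem_filter, mem_univ, true_and] at ha
      simp only [Set.mem_ofPred_eq, mem_filter, Fintype.mem_piFinset, mem_box]
      constructor
      · rintro ⟨⟨h, -⟩, rfl⟩ i
        exact ⟨h i, rfl⟩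
      · intro h
        have h' : reduce q A = a := funext fun i => (h i).2
        exact ⟨⟨fun i => (h i).1, h' ▸ ha⟩, h'⟩
    · intro A hA
      simpa using (mem_filter.1 hA).2
  rw [boxProportion, hfib]
  push_cast
  simp_rw [prod_div_distrib, prod_const, card_univ, sum_div]

theorem card_filter_mem_eq_ncard {α : Type} [Fintype α] (S : Set α) [DecidablePred (· ∈ S)] :
    #{a | a ∈ S} = S.ncard := by
  rw [← Set.ncard_coe_finset]
  congr 1
  ext
  simp

theorem tendsto_boxProportion_reduce {q : ℕ} [NeZero q] (S : Set (ι → ZMod q)) :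
    Tendsto (boxProportion {A : ι → ℤ | reduce q A ∈ S}) atTop (𝓝 (residueDensity q S)) := by
  classical
  have h : residueDensity q S = ∑ a : ι → ZMod q with a ∈ S, ∏ _i : ι, (1 / q : ℝ) := by
    rw [sum_const, card_filter_mem_eq_ncard, prod_const, card_univ, nsmul_eq_mul, one_div_pow,
      residueDensity, mul_one_div]
  rw [h]
  simp_rw [funext (boxProportion_reduce_eq S)]
  exact tendsto_finsetSum _ fun a _ => tendsto_finsetProd _ fun i _ =>
    tendsto_residueCount_div (NeZero.pos q) (a i)

/-- For `q ≤ 2H` a residue class has at most `2H/q + 1 ≤ 2 · 2H/q` members, a loss of `2` per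
coordinate. This majorant, uniform in `H`, is what dominated convergence needs. -/
theorem boxProportion_reduce_le {q : ℕ} [NeZero q] (S : Set (ι → ZMod q)) {H : ℕ}
    (hqH : q ≤ 2 * H) :
    boxProportion {A : ι → ℤ | reduce q A ∈ S} H ≤
      2 ^ Fintype.card ι * residueDensity q S := by
  classical
  have hq : 0 < q := NeZero.pos q
  have hH : 0 < H := by omega
  have hq' : (0 : ℝ) < q := by exact_mod_cast hq
  have hbd : ∀ a : ZMod q, (residueCount q a H : ℝ) / (2 * H) ≤ 2 / q := by
    intro a
    have h1 := (abs_le.1 (abs_residueCount_div_sub_le hq a hH)).2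
    have h2 : (1 : ℝ) / (2 * H) ≤ 1 / q :=
      one_div_le_one_div_of_le hq' (by exact_mod_cast hqH)
    have h3 : (2 : ℝ) / q = 1 / q + 1 / q := by ring
    linarith
  rw [boxProportion_reduce_eq]
  refine (sum_le_sum fun a _ => prod_le_prod (fun _ _ => by positivity) fun i _ =>
    hbd (a i)).trans_eq ?_
  rw [sum_const, card_filter_mem_eq_ncard, prod_const, card_univ, nsmul_eq_mul, residueDensity,
    div_pow]
  ring

/-- Independence of the reductions modulo finitely many primes. -/
theorem tendsto_boxProportion_forall_reduce (s : Finset Nat.Primes)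
    (S : ∀ p : Nat.Primes, Set (ι → ZMod (p : ℕ))) :
    Tendsto (boxProportion {A : ι → ℤ | ∀ p ∈ s, reduce (p : ℕ) A ∈ S p}) atTop
      (𝓝 (∏ p ∈ s, residueDensity (p : ℕ) (S p))) := by
  classical
  let a : s → ℕ := fun p => ((p : Nat.Primes) : ℕ)
  have hcop : Pairwise (Function.onFun Nat.Coprime a) := fun p q hpq =>
    (Nat.coprime_primes p.1.2 q.1.2).2 fun h => hpq (Subtype.ext (Subtype.ext h))
  let N := ∏ p, a p
  have hN : N ≠ 0 := prod_ne_zero_iff.2 fun p _ => p.1.2.ne_zero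
  have : NeZero N := ⟨hN⟩
  -- The Chinese remainder theorem in each coordinate turns the conditions into a single one modulo
  -- the product `N`.
  let E : (ι → ZMod N) ≃ ∀ p : s, ι → ZMod (a p) :=
    ((Equiv.refl ι).arrowCongr (ZMod.prodEquivPi a hcop).toEquiv).trans (Equiv.piComm _)
  let T : Set (ι → ZMod N) := {b | ∀ p : s, E b p ∈ S p}
  have hT : {A : ι → ℤ | ∀ p ∈ s, reduce (p : ℕ) A ∈ S p} = {A | reduce N A ∈ T} := by
    ext A
    have hE : ∀ p : s, E (reduce N A) p = reduce (a p) A := by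
      intro p
      ext i
      change ZMod.prodEquivPi a hcop (A i : ZMod N) p = _
      rw [map_intCast]
      rfl
    simp only [Set.mem_ofPred_eq, T, hE, Subtype.forall]
    rfl
  have hcard : T.ncard = ∏ p : s, (S p).ncard := by
    rw [← Nat.card_coe_set_eq]
    simp_rw [← Nat.card_coe_set_eq]
    rw [← Nat.card_pi]
    exact Nat.card_congr ((E.subtypeEquiv fun b => Iff.rfl).trans Equiv.subtypePiEquivPi)
  have hdens : residueDensity N T = ∏ p ∈ s, residueDensity (p : ℕ) (S p) := by
    rw [← prod_coe_sort s fun p => residueDensity (p : ℕ) (S p), residueDensity, hcard]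
    simp_rw [residueDensity]
    rw [prod_div_distrib, prod_pow]
    simp only [N, Nat.cast_prod, prod_coe_sort_eq_attach]
    rfl
  rw [hT, ← hdens]
  exact tendsto_boxProportion_reduce T

end Residues

/-! ### The proportion of singular matrices modulo `p`. -/

section Singular

theorem one_sub_prod_one_sub_le {α : Type} (s : Finset α) {x : α → ℝ}
    (hx : ∀ i ∈ s, 0 ≤ x i ∧ x i ≤ 1) : 1 - ∏ i ∈ s, (1 - x i) ≤ ∑ i ∈ s, x i := by
  classical
  induction s using Finset.induction_on with
  | empty => simp
  | insert a s ha ih =>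
    rw [prod_insert ha, sum_insert ha]
    have h1 := hx a (mem_insert_self a s)
    have h2 := ih fun i hi => hx i (mem_insert_of_mem hi)
    have h3 : ∏ i ∈ s, (1 - x i) ≤ 1 := prod_le_one
      (fun i hi => by linarith [(hx i (mem_insert_of_mem hi)).2])
      (fun i hi => by linarith [(hx i (mem_insert_of_mem hi)).1])
    nlinarith

theorem ncard_compl_singularSet {n m p : ℕ} [Fact p.Prime] (hnm : n ≤ m) :
    (singularSet n m p)ᶜ.ncard = ∏ i : Fin n, (p ^ m - p ^ (i : ℕ)) := by
  have h := card_linearIndependent (K := ZMod p) (V := Fin m → ZMod p) (k := n) (by simpa using hnm)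
  rw [ZMod.card, Module.finrank_fin_fun] at h
  rw [← h, ← Nat.card_coe_set_eq]
  refine Nat.card_congr ((Equiv.curry (Fin n) (Fin m) (ZMod p)).subtypeEquiv fun A => ?_)
  rw [Set.mem_compl_iff, mem_singularSet_iff_not_linearIndependent, not_not]
  rfl

/-- The proportion of singular matrices modulo a prime. -/
theorem residueDensity_singularSet {n m p : ℕ} [Fact p.Prime] (hnm : n ≤ m) :
    residueDensity p (singularSet n m p) =
      1 - ∏ i ∈ range n, (1 - 1 / (p : ℝ) ^ (m - i)) := by
  have hp : 0 < p := (Fact.out : p.Prime).pos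
  have hp' : (p : ℝ) ≠ 0 := by positivity
  have h := Set.ncard_add_ncard_compl (singularSet n m p)
  rw [ncard_compl_singularSet hnm, Nat.card_eq_fintype_card, Fintype.card_fun, ZMod.card] at h
  have hR : ((singularSet n m p).ncard : ℝ) =
      (p : ℝ) ^ Fintype.card (Fin n × Fin m) - ∏ i ∈ range n, ((p : ℝ) ^ m - (p : ℝ) ^ i) := by
    rw [eq_sub_iff_add_eq, ← Fin.prod_univ_eq_prod_range fun i => (p : ℝ) ^ m - (p : ℝ) ^ i]
    rw [← Nat.cast_inj (R := ℝ)] at h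
    push_cast at h
    rw [← h]
    congr 1
    refine prod_congr rfl fun i _ => ?_
    rw [Nat.cast_sub (Nat.pow_le_pow_right hp (by omega))]
    push_cast
    rfl
  rw [residueDensity, hR, sub_div, div_self (by positivity), Fintype.card_prod, Fintype.card_fin,
    Fintype.card_fin, mul_comm n m, pow_mul]
  congr 1
  rw [← card_range n, ← prod_const, card_range, ← prod_div_distrib]
  refine prod_congr rfl fun i hi => ?_
  have him : i ≤ m := (mem_range.1 hi).le.trans hnm
  rw [sub_div, div_self (by positivity)]
  congr 1
  rw [div_eq_div_iff (by positivity) (by positivity), ← pow_add, one_mul]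
  congr 1
  omega

/-- Since `n < m`, all exponents `m - i` are at least `2`, so the local densities are summable over
the primes. -/
theorem residueDensity_singularSet_le {n m p : ℕ} [Fact p.Prime] (hnm : n < m) :
    residueDensity p (singularSet n m p) ≤ n * ((p : ℝ) ^ 2)⁻¹ := by
  have hp : (1 : ℝ) ≤ p := by exact_mod_cast (Fact.out : p.Prime).one_le
  rw [residueDensity_singularSet hnm.le]
  refine (one_sub_prod_one_sub_le _ fun i _ => ⟨by positivity, ?_⟩).trans ?_
  · exact div_le_one_of_le₀ (one_le_pow₀ hp) (by positivity)
  · refine (sum_le_card_nsmul (range n) _ ((p : ℝ) ^ 2)⁻¹ fun i hi => ?_).trans_eq (by simp)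
    have := mem_range.1 hi
    rw [one_div]
    exact inv_anti₀ (by positivity) (pow_le_pow_right₀ hp (by omega))

/-- The zero matrix is singular; `0 < n` is needed because the empty determinant is `1`. -/
theorem residueDensity_singularSet_pos {n m p : ℕ} [Fact p.Prime] (hn : 0 < n) :
    0 < residueDensity p (singularSet n m p) := by
  have hp : 0 < p := (Fact.out : p.Prime).pos
  have h0 : (0 : Fin n × Fin m → ZMod p) ∈ singularSet n m p := by
    intro c
    have : Nonempty (Fin n) := ⟨⟨0, hn⟩⟩
    exact Matrix.det_zero
  have : 0 < (singularSet n m p).ncard := (Set.ncard_pos).2 ⟨0, h0⟩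
  unfold residueDensity
  positivity

end Singular

end LocalGlobal

/-! ### Haar measure of the sets `U_p`. -/

namespace LocalGlobal

open Finset MeasureTheory

section Haar

/-- An invariant probability measure is equidistributed over the fibres of a homomorphism onto a
finite group. -/
theorem measureReal_preimage_eq {G F : Type} [AddCommGroup G] [MeasurableSpace G]
    [MeasurableAdd G] (μ : Measure G) [μ.IsAddLeftInvariant] [IsProbabilityMeasure μ]
    [AddCommGroup F] [Fintype F] (f : G →+ F) (hf : Function.Surjective f)
    (hmeas : ∀ a, MeasurableSet (f ⁻¹' {a})) (S : Set F) :
    μ.real (f ⁻¹' S) = S.ncard / Fintype.card F := by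
  classical
  -- The fibre over `a` is a translate of the fibre over `0`.
  have hfib : ∀ a, μ.real (f ⁻¹' {a}) = μ.real (f ⁻¹' {0}) := by
    intro a
    obtain ⟨g, hg⟩ := hf (-a)
    rw [measureReal_def, measureReal_def, ← measure_preimage_add μ g (f ⁻¹' {0})]
    congr 2
    ext x
    simpa [hg, neg_add_eq_zero] using eq_comm
  have hsum : ∀ T : Set F, μ.real (f ⁻¹' T) = T.ncard * μ.real (f ⁻¹' {0}) := by
    intro T
    have hT : f ⁻¹' T = ⋃ a ∈ ({a | a ∈ T} : Finset F), f ⁻¹' {a} := by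
      ext x
      simp
    rw [hT, measureReal_biUnion_finset _ fun a _ => hmeas a, sum_congr rfl fun a _ => hfib a,
      sum_const, card_filter_mem_eq_ncard, nsmul_eq_mul]
    intro a _ b _ hab
    exact Disjoint.preimage f (Set.disjoint_singleton.2 hab)
  have h1 := hsum Set.univ
  rw [Set.preimage_univ, probReal_univ, Set.ncard_univ, Nat.card_eq_fintype_card] at h1
  rw [hsum S, div_eq_mul_one_div, eq_one_div_of_mul_eq_one_right h1.symm]

/-- Points at sup-distance less than `1` have the same reduction modulo `p`. -/
theorem isOpen_preimage_toZMod {ι : Type} [Fintype ι] (p : Nat.Primes)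
    (S : Set (ι → ZMod (p : ℕ))) :
    IsOpen {A : ι → ℤ_[(p : ℕ)] | (fun i => PadicInt.toZMod (A i)) ∈ S} := by
  rw [Metric.isOpen_iff]
  intro A hA
  refine ⟨1, one_pos, fun B hB => ?_⟩
  have h : (fun i => PadicInt.toZMod (B i)) = fun i => PadicInt.toZMod (A i) := by
    funext i
    rw [← sub_eq_zero, ← map_sub, ← RingHom.mem_ker, PadicInt.ker_toZMod,
      IsLocalRing.mem_maximalIdeal, PadicInt.mem_nonunits, ← dist_eq_norm]
    exact (dist_pi_lt_iff one_pos).1 hB i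
  change (fun i => PadicInt.toZMod (B i)) ∈ S
  rwa [h]

theorem isClopen_preimage_toZMod {ι : Type} [Fintype ι] (p : Nat.Primes)
    (S : Set (ι → ZMod (p : ℕ))) :
    IsClopen {A : ι → ℤ_[(p : ℕ)] | (fun i => PadicInt.toZMod (A i)) ∈ S} :=
  ⟨⟨isOpen_preimage_toZMod p Sᶜ⟩, isOpen_preimage_toZMod p S⟩

theorem toReal_padicHaar_preimage_toZMod {ι : Type} [Fintype ι] (p : Nat.Primes)
    (S : Set (ι → ZMod (p : ℕ))) :
    (padicHaar ι p {A | (fun i => PadicInt.toZMod (A i)) ∈ S}).toReal =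
      residueDensity (p : ℕ) S := by
  classical
  let _ : MeasurableSpace (ι → ℤ_[(p : ℕ)]) := borel _
  have : BorelSpace (ι → ℤ_[(p : ℕ)]) := ⟨rfl⟩
  let μ : Measure (ι → ℤ_[(p : ℕ)]) := Measure.addHaarMeasure ⊤
  have : IsProbabilityMeasure μ := ⟨Measure.addHaarMeasure_self⟩
  let f : (ι → ℤ_[(p : ℕ)]) →+ (ι → ZMod (p : ℕ)) :=
    (PadicInt.toZMod (p := (p : ℕ))).toAddMonoidHom.compLeft ι
  have hf : Function.Surjective f := by
    intro a
    choose x hx using fun i => ZMod.ringHom_surjective (PadicInt.toZMod (p := (p : ℕ))) (a i)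
    exact ⟨x, funext hx⟩
  have h := measureReal_preimage_eq μ f hf
    (fun a => (isOpen_preimage_toZMod p {a}).measurableSet) S
  rw [Fintype.card_fun, ZMod.card, Nat.cast_pow] at h
  exact h

theorem minorSystem_atPrime_eq (n m : ℕ) (p : Nat.Primes) :
    (minorSystem n m).atPrime p =
      {A | (fun i => PadicInt.toZMod (A i)) ∈ singularSet n m (p : ℕ)} :=
  Set.ext fun _ => mem_minorSystem_atPrime_iff

theorem localMeasure_minorSystem_some (n m : ℕ) (p : Nat.Primes) :
    (minorSystem n m).localMeasure (some p) = residueDensity (p : ℕ) (singularSet n m (p : ℕ)) := by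
  rw [System.localMeasure, minorSystem_atPrime_eq, toReal_padicHaar_preimage_toZMod]

theorem localMeasure_minorSystem_none (n m : ℕ) : (minorSystem n m).localMeasure none = 0 := by
  simp [System.localMeasure, minorSystem]

theorem padicHaar_frontier_minorSystem (n m : ℕ) (p : Nat.Primes) :
    padicHaar (Fin n × Fin m) p (frontier ((minorSystem n m).atPrime p)) = 0 := by
  rw [minorSystem_atPrime_eq, (isClopen_preimage_toZMod p _).frontier_eq, measure_empty]

theorem hasSum_localMeasure_minorSystem_iff {n m : ℕ} {μ : ℝ} :
    HasSum (minorSystem n m).localMeasure μ ↔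
      HasSum (fun p : Nat.Primes => residueDensity (p : ℕ) (singularSet n m (p : ℕ))) μ := by
  rw [← (Option.some_injective Nat.Primes).hasSum_iff]
  · exact iff_of_eq (congrArg (HasSum · μ) (funext fun p => localMeasure_minorSystem_some n m p))
  · rintro (_ | p) hp
    · exact localMeasure_minorSystem_none n m
    · exact absurd ⟨p, rfl⟩ hp

end Haar

end LocalGlobal

/-! ### Passing to the limit: expected value, tail, and density of `R`. -/

namespace LocalGlobal

open Finset Filter Topology

section BoxProportion

variable {ι : Type} [Fintype ι] [DecidableEq ι]

theorem boxProportion_eq (T : Set (ι → ℤ)) [DecidablePred (· ∈ T)] (H : ℕ) :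
    boxProportion T H = (#{A ∈ box ι H | A ∈ T} : ℝ) / (2 * (H : ℝ)) ^ Fintype.card ι := by
  unfold boxProportion
  congr!

theorem boxProportion_nonneg (T : Set (ι → ℤ)) (H : ℕ) : 0 ≤ boxProportion T H := by
  unfold boxProportion
  positivity

theorem boxProportion_mono {S T : Set (ι → ℤ)} (h : S ⊆ T) (H : ℕ) :
    boxProportion S H ≤ boxProportion T H := by
  classical
  unfold boxProportion
  gcongr

theorem boxProportion_union_le (S T : Set (ι → ℤ)) (H : ℕ) :
    boxProportion (S ∪ T) H ≤ boxProportion S H + boxProportion T H := by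
  classical
  unfold boxProportion
  rw [← add_div]
  gcongr
  rw [← Nat.cast_add, Nat.cast_le]
  refine le_trans (card_le_card fun A hA => ?_) (card_union_le _ _)
  simpa [mem_filter, and_or_left] using hA

theorem boxProportion_union {S T : Set (ι → ℤ)} (hST : Disjoint S T) (H : ℕ) :
    boxProportion (S ∪ T) H = boxProportion S H + boxProportion T H := by
  classical
  unfold boxProportion
  rw [← add_div, ← Nat.cast_add, ← card_union_of_disjoint]
  · congr 3
    ext A
    simp [and_or_left]
  · exact disjoint_filter.2 fun A _ hS hT => Set.disjoint_left.1 hST hS hT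

theorem boxProportion_univ {H : ℕ} (hH : 0 < H) :
    boxProportion (Set.univ : Set (ι → ℤ)) H = 1 := by
  classical
  have h : (0 : ℝ) < (2 * (H : ℝ)) ^ Fintype.card ι := by positivity
  rw [boxProportion_eq, filter_true_of_mem fun _ _ => Set.mem_univ _, card_box]
  push_cast
  exact div_self h.ne'

theorem boxProportion_compl (T : Set (ι → ℤ)) {H : ℕ} (hH : 0 < H) :
    boxProportion Tᶜ H = 1 - boxProportion T H := by
  rw [eq_sub_iff_add_eq, ← boxProportion_union disjoint_compl_left, Set.compl_union_self,
    boxProportion_univ hH]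

theorem div_pow_le_div_of_mul_le {H a C d : ℕ} (hH : 0 < H)
    (h : 2 * H * a ≤ C * (2 * H) ^ d) : (a : ℝ) / (2 * (H : ℝ)) ^ d ≤ C / (2 * (H : ℝ)) := by
  have hH' : (0 : ℝ) < 2 * H := by positivity
  rw [div_le_div_iff₀ (by positivity) hH', mul_comm (a : ℝ)]
  exact_mod_cast h

end BoxProportion

section Primes

theorem finite_primes_le (N : ℕ) : {p : Nat.Primes | (p : ℕ) ≤ N}.Finite :=
  (Set.finite_Iic N).preimage Subtype.val_injective.injOn

/-- The primes up to `N`. -/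
noncomputable def primesUpTo (N : ℕ) : Finset Nat.Primes := (finite_primes_le N).toFinset

theorem mem_primesUpTo {N : ℕ} {p : Nat.Primes} : p ∈ primesUpTo N ↔ (p : ℕ) ≤ N := by
  simp [primesUpTo]

theorem tendsto_primesUpTo : Tendsto primesUpTo atTop atTop := by
  refine tendsto_atTop_finset_of_monotone (fun M N h p hp => ?_) fun p =>
    ⟨p, mem_primesUpTo.2 le_rfl⟩
  exact mem_primesUpTo.2 ((mem_primesUpTo.1 hp).trans h)

theorem summable_singularDensity {n m : ℕ} (hnm : n < m) :
    Summable fun p : Nat.Primes => residueDensity (p : ℕ) (singularSet n m (p : ℕ)) := by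
  have h : Summable fun p : Nat.Primes => (n : ℝ) * (((p : ℕ) : ℝ) ^ 2)⁻¹ :=
    ((Real.summable_nat_pow_inv.2 one_lt_two).comp_injective
      (Subtype.val_injective : Function.Injective fun p : Nat.Primes => (p : ℕ))).mul_left _
  exact h.of_nonneg_of_le (fun p => residueDensity_nonneg _ _)
    fun p => residueDensity_singularSet_le hnm

end Primes

section MinorSystem

variable {n m : ℕ}

/-- The integer points lying in `U_p`. -/
def primeLocus (n m : ℕ) (p : Nat.Primes) : Set (Fin n × Fin m → ℤ) :=
  {A | reduce (p : ℕ) A ∈ singularSet n m (p : ℕ)}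

theorem mem_primeLocus {p : Nat.Primes} {A : Fin n × Fin m → ℤ} :
    A ∈ primeLocus n m p ↔ (minorSystem n m).Mem A (some p) :=
  minorSystem_mem_some_iff_mem_singularSet.symm

theorem boxProportion_exceptional_le (hnm : n < m) {H : ℕ} (hH : 0 < H) :
    boxProportion (minorSystem n m).exceptional H ≤ n / (2 * (H : ℝ)) := by
  classical
  refine (boxProportion_mono (T := {A | rowMinor (toMatrix A) (Fin.castLEOrderEmb hnm.le) = 0})
    (fun A hA => mem_exceptional_minorSystem_iff.1 hA _) H).trans ?_
  refine div_pow_le_div_of_mul_le hH ?_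
  convert mul_card_box_rowMinor_eq_zero_le H (Fin.castLEOrderEmb hnm.le)
  rfl

theorem tendsto_boxProportion_exceptional (hnm : n < m) :
    Tendsto (boxProportion (minorSystem n m).exceptional) atTop (𝓝 0) := by
  refine tendsto_of_tendsto_of_tendsto_of_le_of_le' tendsto_const_nhds
    (tendsto_const_div_two_mul n) (Eventually.of_forall fun _ => boxProportion_nonneg _ _) ?_
  filter_upwards [eventually_gt_atTop 0] with H hH
  exact boxProportion_exceptional_le hnm hH

theorem tendsto_boxProportion_primeLocus_diff (hnm : n < m) (p : Nat.Primes) :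
    Tendsto (boxProportion (primeLocus n m p \ (minorSystem n m).exceptional)) atTop
      (𝓝 (residueDensity (p : ℕ) (singularSet n m (p : ℕ)))) := by
  have h : Tendsto (boxProportion (primeLocus n m p)) atTop _ :=
    tendsto_boxProportion_reduce (singularSet n m (p : ℕ))
  have h' := h.sub (tendsto_boxProportion_exceptional hnm)
  rw [sub_zero] at h'
  refine tendsto_of_tendsto_of_tendsto_of_le_of_le h' h (fun H => ?_)
    fun H => boxProportion_mono Set.sdiff_subset H
  rw [sub_le_iff_le_add]
  exact (boxProportion_mono (by rw [Set.sdiff_union_self]; exact Set.subset_union_left) H).trans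
    (boxProportion_union_le _ _ H)

theorem finite_setOf_mem_of_notMem_exceptional {A : Fin n × Fin m → ℤ}
    (hA : A ∉ (minorSystem n m).exceptional) :
    {p | (minorSystem n m).Mem A (some p)}.Finite := by
  rw [System.exceptional, Set.mem_ofPred_eq, Set.not_infinite, places_minorSystem_eq_image] at hA
  exact hA.of_finite_image (Option.some_injective _).injOn

-- The cut at `2H` is where `boxProportion_reduce_le` stops applying and the bound on `largeCount`
-- takes over.
open Classical in
theorem ncard_places_eq {A : Fin n × Fin m → ℤ} (hA : A ∉ (minorSystem n m).exceptional) (H : ℕ) :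
    ((minorSystem n m).places A).ncard =
      #{p ∈ primesUpTo (2 * H) | A ∈ primeLocus n m p} + largeCount H A := by
  have hfin := finite_setOf_mem_of_notMem_exceptional hA
  rw [places_minorSystem_eq_image, Set.ncard_image_of_injective _ (Option.some_injective _),
    largeCount, ← Set.ncard_coe_finset, ← Set.ncard_union_eq ?_ (finite_toSet _)
      (hfin.subset fun p hp => hp.2)]
  · congr 1
    ext p
    simp only [Set.mem_union, mem_coe, mem_filter, mem_primesUpTo, mem_primeLocus,
      Set.mem_ofPred_eq]
    have := le_or_gt (p : ℕ) (2 * H)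
    tauto
  · rw [Set.disjoint_left]
    intro p hp hp'
    exact absurd (mem_primesUpTo.1 (mem_filter.1 (mem_coe.1 hp)).1) (not_le.2 hp'.1)

open Classical in
theorem sum_ncard_places_div_eq (n m H : ℕ) :
    (∑ A ∈ box (Fin n × Fin m) H with A ∉ (minorSystem n m).exceptional,
        (((minorSystem n m).places A).ncard : ℝ)) / (2 * (H : ℝ)) ^ Fintype.card (Fin n × Fin m) =
      ∑ p ∈ primesUpTo (2 * H),
        boxProportion (primeLocus n m p \ (minorSystem n m).exceptional) H +
      ((∑ A ∈ box (Fin n × Fin m) H with A ∉ (minorSystem n m).exceptional,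
        largeCount H A : ℕ) : ℝ) / (2 * (H : ℝ)) ^ Fintype.card (Fin n × Fin m) := by
  have h : ∑ A ∈ box (Fin n × Fin m) H with A ∉ (minorSystem n m).exceptional,
        ((minorSystem n m).places A).ncard =
      ∑ p ∈ primesUpTo (2 * H), #{A ∈ box (Fin n × Fin m) H |
          A ∈ primeLocus n m p \ (minorSystem n m).exceptional} +
        ∑ A ∈ box (Fin n × Fin m) H with A ∉ (minorSystem n m).exceptional, largeCount H A := by
    rw [sum_congr rfl fun A hA => ncard_places_eq (mem_filter.1 hA).2 H, sum_add_distrib]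
    congr 1
    simp_rw [card_filter]
    rw [sum_comm]
    refine sum_congr rfl fun p _ => ?_
    rw [sum_filter]
    refine sum_congr rfl fun A _ => ?_
    by_cases h1 : A ∈ (minorSystem n m).exceptional <;> simp [h1]
  rw [← Nat.cast_sum, h, Nat.cast_add, add_div, Nat.cast_sum, sum_div]
  simp_rw [boxProportion_eq]

/-- Dominated convergence with majorant `2^{nm} s_p`; extending the summand by zero beyond `2H`
makes the domination hold for every `H`. -/
theorem tendsto_sum_primesUpTo_boxProportion (hnm : n < m) :
    Tendsto (fun H => ∑ p ∈ primesUpTo (2 * H),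
        boxProportion (primeLocus n m p \ (minorSystem n m).exceptional) H) atTop
      (𝓝 (∑' p : Nat.Primes, residueDensity (p : ℕ) (singularSet n m (p : ℕ)))) := by
  classical
  have h := tendsto_tsum_of_dominated_convergence (𝓕 := atTop)
    (f := fun (H : ℕ) (p : Nat.Primes) => if (p : ℕ) ≤ 2 * H then
      boxProportion (primeLocus n m p \ (minorSystem n m).exceptional) H else 0)
    (g := fun p : Nat.Primes => residueDensity (p : ℕ) (singularSet n m (p : ℕ)))
    (bound := fun p => 2 ^ Fintype.card (Fin n × Fin m) *
      residueDensity (p : ℕ) (singularSet n m (p : ℕ)))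
    ((summable_singularDensity hnm).mul_left _) (fun p => ?_) (Eventually.of_forall fun H p => ?_)
  · refine h.congr fun H => ?_
    rw [tsum_eq_sum (s := primesUpTo (2 * H)) fun p hp => if_neg (by rwa [mem_primesUpTo] at hp)]
    exact sum_congr rfl fun p hp => if_pos (mem_primesUpTo.1 hp)
  · refine (tendsto_boxProportion_primeLocus_diff hnm p).congr' ?_
    filter_upwards [eventually_ge_atTop (p : ℕ)] with H hH
    rw [if_pos (by omega)]
  · split_ifs with hp
    · rw [Real.norm_of_nonneg (boxProportion_nonneg _ _)]
      exact (boxProportion_mono Set.sdiff_subset H).trans (boxProportion_reduce_le _ hp)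
    · rw [norm_zero]
      exact mul_nonneg (by positivity) (residueDensity_nonneg _ _)

theorem hasExpectedValue_minorSystem (hnm : n < m) :
    (minorSystem n m).HasExpectedValue
      (∑' p : Nat.Primes, residueDensity (p : ℕ) (singularSet n m (p : ℕ))) := by
  obtain ⟨C, hC⟩ := exists_sum_largeCount_le hnm
  unfold System.HasExpectedValue
  simp_rw [sum_ncard_places_div_eq]
  rw [← add_zero (∑' p : Nat.Primes, residueDensity (p : ℕ) (singularSet n m (p : ℕ)))]
  refine (tendsto_sum_primesUpTo_boxProportion hnm).add ?_
  refine tendsto_of_tendsto_of_tendsto_of_le_of_le' tendsto_const_nhds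
    (tendsto_const_div_two_mul C) (Eventually.of_forall fun _ => by positivity) ?_
  filter_upwards [eventually_gt_atTop 0] with H hH
  exact div_pow_le_div_of_mul_le hH (hC H hH)

/-- The integer points lying in `U_p` for some prime `p > M`. -/
def tailLocus (n m M : ℕ) : Set (Fin n × Fin m → ℤ) :=
  {A | ∃ p : Nat.Primes, M < (p : ℕ) ∧ (minorSystem n m).Mem A (some p)}

open Classical in
/-- A multiple of the tail of the series of the local densities. -/
noncomputable def tailBound (n m M : ℕ) : ℝ :=
  ∑' p : Nat.Primes, if M < (p : ℕ) then
    2 ^ Fintype.card (Fin n × Fin m) * residueDensity (p : ℕ) (singularSet n m (p : ℕ)) else 0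

theorem summable_tailBound (hnm : n < m) (M : ℕ) :
    Summable fun p : Nat.Primes => if M < (p : ℕ) then
      2 ^ Fintype.card (Fin n × Fin m) * residueDensity (p : ℕ) (singularSet n m (p : ℕ))
        else 0 := by
  have hs := (summable_singularDensity hnm).mul_left (2 ^ Fintype.card (Fin n × Fin m))
  have h0 : ∀ p : Nat.Primes, 0 ≤ 2 ^ Fintype.card (Fin n × Fin m) *
      residueDensity (p : ℕ) (singularSet n m (p : ℕ)) := fun p =>
    mul_nonneg (by positivity) (residueDensity_nonneg _ _)
  refine hs.of_nonneg_of_le (fun p => ?_) fun p => ?_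
  · split_ifs
    exacts [h0 p, le_rfl]
  · split_ifs
    exacts [le_rfl, h0 p]

theorem tendsto_tailBound (hnm : n < m) : Tendsto (tailBound n m) atTop (𝓝 0) := by
  have hs := (summable_singularDensity hnm).mul_left (2 ^ Fintype.card (Fin n × Fin m))
  have h0 : ∀ p : Nat.Primes, 0 ≤ 2 ^ Fintype.card (Fin n × Fin m) *
      residueDensity (p : ℕ) (singularSet n m (p : ℕ)) := fun p =>
    mul_nonneg (by positivity) (residueDensity_nonneg _ _)
  rw [← tsum_zero (α := ℝ) (β := Nat.Primes)]
  refine tendsto_tsum_of_dominated_convergence hs (fun p => ?_)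
    (Eventually.of_forall fun M p => ?_)
  · refine tendsto_const_nhds.congr' ?_
    filter_upwards [eventually_ge_atTop (p : ℕ)] with M hM
    rw [if_neg (by omega)]
  · split_ifs
    · rw [Real.norm_of_nonneg (h0 p)]
    · rw [norm_zero]
      exact h0 p

/-- A point of the tail is exceptional, or lies in `U_p` with `M < p ≤ 2H`, or has `largeCount` at
least `1`. The constant is independent of `M`, so its term disappears as `H → ∞` with `M` fixed. -/
theorem exists_boxProportion_tailLocus_le (hnm : n < m) : ∃ C : ℝ, ∀ M H : ℕ, 0 < H →
    boxProportion (tailLocus n m M) H ≤ tailBound n m M + C / (2 * (H : ℝ)) := by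
  classical
  obtain ⟨C, hC⟩ := exists_sum_largeCount_le hnm
  refine ⟨n + C, fun M H hH => ?_⟩
  set B := box (Fin n × Fin m) H
  set I := (minorSystem n m).exceptional with hI
  set P : Finset Nat.Primes := {p ∈ primesUpTo (2 * H) | M < (p : ℕ)} with hP
  have hcount : #{A ∈ B | A ∈ tailLocus n m M} ≤ #{A ∈ B | A ∈ I} +
      ∑ p ∈ P, #{A ∈ B | A ∈ primeLocus n m p} + ∑ A ∈ B with A ∉ I, largeCount H A := by
    simp_rw [card_filter]
    rw [sum_comm, sum_filter, ← sum_add_distrib, ← sum_add_distrib]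
    refine sum_le_sum fun A _ => ?_
    by_cases hAT : A ∈ tailLocus n m M
    · rw [if_pos hAT]
      by_cases hAI : A ∈ I
      · rw [if_pos hAI]
        omega
      rw [if_pos hAI]
      obtain ⟨p, hMp, hp⟩ := hAT
      rcases le_or_gt (p : ℕ) (2 * H) with hle | hlt
      · have hpP : p ∈ P := mem_filter.2 ⟨mem_primesUpTo.2 hle, hMp⟩
        have := single_le_sum (f := fun p => if A ∈ primeLocus n m p then 1 else 0)
          (fun _ _ => Nat.zero_le _) hpP
        simp only [if_pos (mem_primeLocus.2 hp)] at this
        omega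
      · have : 0 < largeCount H A := by
          -- An infinite set has `ncard` zero, hence the separate treatment of exceptional points.
          refine (Set.ncard_pos ?_).2 ⟨p, hlt, hp⟩
          exact (finite_setOf_mem_of_notMem_exceptional hAI).subset fun q hq => hq.2
        omega
    · rw [if_neg hAT]
      exact Nat.zero_le _
  have hprop : boxProportion (tailLocus n m M) H ≤ boxProportion I H +
      ∑ p ∈ P, boxProportion (primeLocus n m p) H +
      ((∑ A ∈ B with A ∉ I, largeCount H A : ℕ) : ℝ) /
        (2 * (H : ℝ)) ^ Fintype.card (Fin n × Fin m) := by
    simp only [boxProportion_eq]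
    rw [← sum_div, ← add_div, ← add_div]
    refine div_le_div_of_nonneg_right ?_ (by positivity)
    exact_mod_cast hcount
  have hmid : ∑ p ∈ P, boxProportion (primeLocus n m p) H ≤ tailBound n m M := by
    refine le_trans (sum_le_sum fun p hp => ?_) ((summable_tailBound hnm M).sum_le_tsum P
      fun p _ => ?_)
    · rw [if_pos (mem_filter.1 hp).2]
      exact boxProportion_reduce_le _ (mem_primesUpTo.1 (mem_filter.1 hp).1)
    · split_ifs
      exacts [mul_nonneg (by positivity) (residueDensity_nonneg _ _), le_rfl]
  have h1 := boxProportion_exceptional_le hnm hH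
  have h2 := div_pow_le_div_of_mul_le hH (hC H hH)
  rw [add_div]
  linarith

theorem upperDensity_nonneg_and_le_of_le_add {ι : Type} [Fintype ι] [DecidableEq ι]
    {T : Set (ι → ℤ)} {a C : ℝ} (h : ∀ H : ℕ, 0 < H → boxProportion T H ≤ a + C / (2 * (H : ℝ))) :
    0 ≤ upperDensity T ∧ upperDensity T ≤ a := by
  have hlim : Tendsto (fun H : ℕ => a + C / (2 * (H : ℝ))) atTop (𝓝 a) := by
    simpa using (tendsto_const_div_two_mul C).const_add a
  have hev : (fun H => boxProportion T H) ≤ᶠ[atTop] fun H : ℕ => a + C / (2 * (H : ℝ)) := by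
    filter_upwards [eventually_gt_atTop 0] with H hH using h H hH
  have hbdd : IsBoundedUnder (· ≤ ·) atTop (fun H => boxProportion T H) :=
    hlim.isBoundedUnder_le.mono_le hev
  constructor
  · exact le_limsup_of_frequently_le
      (Frequently.of_forall fun H => boxProportion_nonneg T H) hbdd
  · rw [← hlim.limsup_eq]
    exact limsup_le_limsup hev
      (IsCoboundedUnder.of_frequently_ge (Frequently.of_forall fun H => boxProportion_nonneg T H))
      hlim.isBoundedUnder_le

theorem minorSystem_isAdmissible (hnm : n < m) : (minorSystem n m).IsAdmissible where
  cone := Set.image2_empty_right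
  frontier_infinity := by
    change MeasureTheory.volume (frontier ∅) = 0
    rw [frontier_empty, MeasureTheory.measure_empty]
  frontier_prime := padicHaar_frontier_minorSystem n m
  tail := by
    obtain ⟨C, hC⟩ := exists_boxProportion_tailLocus_le hnm
    exact tendsto_of_tendsto_of_tendsto_of_le_of_le tendsto_const_nhds (tendsto_tailBound hnm)
      (fun M => (upperDensity_nonneg_and_le_of_le_add (hC M)).1)
      (fun M => (upperDensity_nonneg_and_le_of_le_add (hC M)).2)

theorem minorSystem_correspondsTo (hnm : n < m) :
    (minorSystem n m).CorrespondsTo (unimodularSet n m)ᶜ := by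
  refine ⟨minorSystem_isAdmissible hnm, ?_⟩
  rw [compl_compl]
  exact Set.ext fun A => mem_unimodularSet_iff hnm.le

/-- The density of the rectangular unimodular matrices is the product of the local densities. -/
theorem tendsto_boxProportion_unimodularSet (hnm : n < m) {L : ℝ}
    (hL : Tendsto (fun M => ∏ p ∈ primesUpTo M,
      residueDensity (p : ℕ) (singularSet n m (p : ℕ))ᶜ) atTop (𝓝 L)) :
    Tendsto (boxProportion (unimodularSet n m)) atTop (𝓝 L) := by
  obtain ⟨C, hC⟩ := exists_boxProportion_tailLocus_le hnm
  let T : ℕ → Set (Fin n × Fin m → ℤ) := fun M =>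
    {A | ∀ p ∈ primesUpTo M, reduce (p : ℕ) A ∈ (singularSet n m (p : ℕ))ᶜ}
  have hT : ∀ M, Tendsto (boxProportion (T M)) atTop _ := fun M =>
    tendsto_boxProportion_forall_reduce (primesUpTo M) fun p => (singularSet n m (p : ℕ))ᶜ
  have hmem : ∀ A, A ∈ unimodularSet n m ↔ ∀ p, A ∉ primeLocus n m p := fun A => by
    simp_rw [mem_unimodularSet_iff hnm.le, places_minorSystem_eq_empty_iff, mem_primeLocus]
  -- `R` is sandwiched: `R ⊆ T M ⊆ R ∪ tailLocus n m M`. First `M` is fixed to make the tail small,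
  -- then `H` grows.
  have hsub : ∀ M, unimodularSet n m ⊆ T M := fun M A hA p _ => (hmem A).1 hA p
  have hsup : ∀ M, T M ⊆ unimodularSet n m ∪ tailLocus n m M := by
    intro M A hA
    by_cases h : A ∈ tailLocus n m M
    · exact Or.inr h
    · refine Or.inl ((hmem A).2 fun p hp => ?_)
      rcases le_or_gt (p : ℕ) M with hle | hlt
      · exact hA p (mem_primesUpTo.2 hle) hp
      · exact h ⟨p, hlt, mem_primeLocus.1 hp⟩
  rw [Metric.tendsto_atTop']
  intro ε hε
  have hε4 : 0 < ε / 4 := by positivity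
  obtain ⟨M, hM1, hM2⟩ := (((Metric.tendsto_nhds.1 hL) (ε / 4) hε4).and
    ((Metric.tendsto_nhds.1 (tendsto_tailBound hnm)) (ε / 4) hε4)).exists
  have hev := (((Metric.tendsto_nhds.1 (hT M)) (ε / 4) hε4).and
    ((Metric.tendsto_nhds.1 (tendsto_const_div_two_mul C)) (ε / 4) hε4)).and
    (eventually_gt_atTop 0)
  obtain ⟨N, hN⟩ := eventually_atTop.1 hev
  refine ⟨N, fun H hH => ?_⟩
  obtain ⟨⟨h1, h2⟩, h0⟩ := hN H hH.le
  have h3 := boxProportion_mono (hsub M) H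
  have h4 := (boxProportion_mono (hsup M) H).trans (boxProportion_union_le _ _ H)
  have h5 := hC M H h0
  rw [Real.dist_eq, abs_lt] at *
  constructor <;> linarith [hM1.1, hM1.2, hM2.1, hM2.2, h1.1, h1.2, h2.1, h2.2]

end MinorSystem

end LocalGlobal

/-! ### Zeta values and the mean over non-unimodular matrices. -/

namespace LocalGlobal

open Finset Filter Topology

theorem residueDensity_compl {ι : Type} [Fintype ι] {q : ℕ} [NeZero q] (S : Set (ι → ZMod q)) :
    residueDensity q Sᶜ = 1 - residueDensity q S := by
  classical
  have hq : (q : ℝ) ≠ 0 := NeZero.ne _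
  have h := Set.ncard_add_ncard_compl S
  rw [Nat.card_eq_fintype_card, Fintype.card_fun, ZMod.card, ← Nat.cast_inj (R := ℝ)] at h
  push_cast at h
  rw [residueDensity, residueDensity, eq_sub_iff_add_eq, ← add_div, add_comm, h,
    div_self (by positivity)]

theorem one_lt_sub_of_mem_range {n m i : ℕ} (hnm : n < m) (hi : i ∈ range n) : 1 < m - i := by
  have := mem_range.1 hi
  omega

theorem tendsto_prod_primesUpTo_one_sub (k : ℕ) (hk : 1 < k) :
    Tendsto (fun M => ∏ p ∈ primesUpTo M, (1 - 1 / ((p : ℕ) : ℂ) ^ k)) atTop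
      (𝓝 (1 / riemannZeta (k : ℂ))) := by
  have hre : 1 < ((k : ℂ)).re := by simpa using hk
  have h : Tendsto (fun s : Finset Nat.Primes => ∏ p ∈ s, (1 - ((p : ℕ) : ℂ) ^ (-(k : ℂ)))⁻¹)
      atTop (𝓝 (riemannZeta k)) := riemannZeta_eulerProduct_hasProd hre
  have h' := (h.comp tendsto_primesUpTo).inv₀ (riemannZeta_ne_zero_of_one_lt_re hre)
  rw [one_div]
  refine h'.congr fun M => ?_
  rw [Function.comp_apply, prod_inv_distrib, inv_inv]
  refine prod_congr rfl fun p _ => ?_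
  rw [Complex.cpow_neg, Complex.cpow_natCast, one_div]

/-- The product of the local densities of the matrices of full rank is a product of inverse zeta
values. -/
theorem exists_tendsto_prod_residueDensity_compl {n m : ℕ} (hnm : n < m) :
    ∃ L : ℝ, Tendsto (fun M => ∏ p ∈ primesUpTo M,
        residueDensity (p : ℕ) (singularSet n m (p : ℕ))ᶜ) atTop (𝓝 L) ∧
      (L : ℂ) = ∏ i ∈ range n, 1 / riemannZeta ((m - i : ℕ) : ℂ) := by
  have h := tendsto_finsetProd (range n) fun i hi =>
    tendsto_prod_primesUpTo_one_sub (m - i) (one_lt_sub_of_mem_range hnm hi)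
  set ℓ := ∏ i ∈ range n, 1 / riemannZeta ((m - i : ℕ) : ℂ)
  have hC : Tendsto (fun M => ((∏ p ∈ primesUpTo M,
      residueDensity (p : ℕ) (singularSet n m (p : ℕ))ᶜ : ℝ) : ℂ)) atTop (𝓝 ℓ) := by
    refine h.congr fun M => ?_
    rw [Finset.prod_comm, Complex.ofReal_prod]
    refine prod_congr rfl fun p _ => ?_
    rw [residueDensity_compl, residueDensity_singularSet hnm.le, sub_sub_cancel]
    push_cast
    rfl
  -- The zeta values are complex, but their product is a limit of real numbers and so equals its
  -- real part.
  have hR : Tendsto (fun M => ∏ p ∈ primesUpTo M,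
      residueDensity (p : ℕ) (singularSet n m (p : ℕ))ᶜ) atTop (𝓝 ℓ.re) :=
    (Complex.continuous_re.tendsto ℓ).comp hC
  exact ⟨ℓ.re, hR, tendsto_nhds_unique ((Complex.continuous_ofReal.tendsto _).comp hR) hC⟩

/-- All factors are at most `1`, and the factor at `2` is a fixed number below `1`. This makes the
denominator `1 - L` nonzero. -/
theorem lt_one_of_tendsto_prod_residueDensity_compl {n m : ℕ} (hn : 0 < n) {L : ℝ}
    (hL : Tendsto (fun M => ∏ p ∈ primesUpTo M,
      residueDensity (p : ℕ) (singularSet n m (p : ℕ))ᶜ) atTop (𝓝 L)) : L < 1 := by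
  classical
  let q : Nat.Primes := ⟨2, Nat.prime_two⟩
  have h01 : ∀ p : Nat.Primes, residueDensity (p : ℕ) (singularSet n m (p : ℕ))ᶜ ≤ 1 := fun p => by
    rw [residueDensity_compl]
    linarith [residueDensity_nonneg (p : ℕ) (singularSet n m (p : ℕ))]
  have hlt : residueDensity (q : ℕ) (singularSet n m (q : ℕ))ᶜ < 1 := by
    rw [residueDensity_compl]
    linarith [residueDensity_singularSet_pos (m := m) (p := (q : ℕ)) hn]
  refine (le_of_tendsto hL ?_).trans_lt hlt
  filter_upwards [eventually_ge_atTop 2] with M hM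
  rw [← mul_prod_erase _ _ (mem_primesUpTo.2 hM : q ∈ primesUpTo M)]
  exact mul_le_of_le_one_right (residueDensity_nonneg _ _)
    (prod_le_one (fun p _ => residueDensity_nonneg _ _) fun p _ => h01 p)

theorem disjoint_exceptional_unimodularSet {n m : ℕ} (hnm : n ≤ m) :
    Disjoint (minorSystem n m).exceptional (unimodularSet n m) := by
  rw [Set.disjoint_left]
  intro A hI hR
  rw [System.exceptional, Set.mem_ofPred_eq, (mem_unimodularSet_iff hnm).1 hR] at hI
  exact hI Set.finite_empty

/-- Points of `R` contribute `0` to the numerator, so discarding them leaves it unchanged. Divided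
by the size of the box, the denominator becomes one minus the proportions of the disjoint sets `I`
and `R`. -/
theorem hasExpectedValueOn_minorSystem {n m : ℕ} (hnm : n < m) {μ L : ℝ}
    (hμ : (minorSystem n m).HasExpectedValue μ)
    (hL : Tendsto (boxProportion (unimodularSet n m)) atTop (𝓝 L)) (hL1 : L < 1) :
    (minorSystem n m).HasExpectedValueOn (unimodularSet n m)ᶜ (μ / (1 - L)) := by
  classical
  have hden : Tendsto (fun H => 1 - (boxProportion (minorSystem n m).exceptional H +
      boxProportion (unimodularSet n m) H)) atTop (𝓝 (1 - L)) := by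
    simpa using ((tendsto_boxProportion_exceptional hnm).add hL).const_sub 1
  unfold System.HasExpectedValue at hμ
  unfold System.HasExpectedValueOn
  refine (hμ.div hden (by linarith)).congr' ?_
  filter_upwards [eventually_gt_atTop 0] with H hH
  have hpow : (2 * (H : ℝ)) ^ Fintype.card (Fin n × Fin m) ≠ 0 := by positivity
  rw [Pi.div_apply, ← boxProportion_union (disjoint_exceptional_unimodularSet hnm.le),
    ← boxProportion_compl _ hH, boxProportion_eq, div_div_div_cancel_right₀ hpow]
  congr 1
  · refine (sum_subset (fun A hA => ?_) fun A hA hA' => ?_).symm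
    · simp only [mem_filter] at hA ⊢
      exact ⟨hA.1, hA.2.1⟩
    · simp only [mem_filter] at hA hA'
      have hR : A ∈ unimodularSet n m := by
        by_contra hR
        exact hA' ⟨hA.1, hA.2, hR⟩
      rw [(mem_unimodularSet_iff hnm.le).1 hR, Set.ncard_empty, Nat.cast_zero]
  · simp only [Set.mem_compl_iff, Set.mem_union, not_or]

end LocalGlobal

theorem mainTheorem2 (n m : ℕ) (hn : 0 < n) (hnm : n < m) :
    (LocalGlobal.minorSystem n m).CorrespondsTo (LocalGlobal.unimodularSet n m)ᶜ ∧
    ∃ μ μ' : ℝ,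
      (LocalGlobal.minorSystem n m).HasExpectedValue μ ∧
      HasSum (LocalGlobal.minorSystem n m).localMeasure μ ∧
      HasSum (fun p : Nat.Primes =>
        1 - ∏ i ∈ Finset.range n, (1 - 1 / ((p : ℕ) : ℝ) ^ (m - i))) μ ∧
      (LocalGlobal.minorSystem n m).HasExpectedValueOn (LocalGlobal.unimodularSet n m)ᶜ μ' ∧
      (μ' : ℂ) =
        (μ : ℂ) / (1 - ∏ i ∈ Finset.range n, 1 / riemannZeta ((m - i : ℕ) : ℂ)) := by
  obtain ⟨L, hL, hζ⟩ := LocalGlobal.exists_tendsto_prod_residueDensity_compl hnm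
  have hsum := (LocalGlobal.summable_singularDensity hnm).hasSum
  have hμ := LocalGlobal.hasExpectedValue_minorSystem hnm
  refine ⟨LocalGlobal.minorSystem_correspondsTo hnm, _, _, hμ,
    LocalGlobal.hasSum_localMeasure_minorSystem_iff.2 hsum, ?_,
    LocalGlobal.hasExpectedValueOn_minorSystem hnm hμ
      (LocalGlobal.tendsto_boxProportion_unimodularSet hnm hL)
      (LocalGlobal.lt_one_of_tendsto_prod_residueDensity_compl hn hL), ?_⟩
  · simpa only [LocalGlobal.residueDensity_singularSet hnm.le] using hsum
  · rw [← hζ]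
    push_cast
    rfl
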